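/- **Setting.** Let $d_x\ge 1$, let $\varepsilon>0$, let $\mu$ be a Borel probability measure on $\mathbb{R}^{d_y}$ with support $\mathcal{U}$, and let $\nu$ be the law of a random vector $(X,Y)\in\mathbb{R}^{d_x}\times\mathbb{R}^{d_y}$. Let $\mathcal{X},\mathcal{Y}$ be the supports of $X$ and $Y$. Assume that $\mathcal{U},\mathcal{X},\mathcal{Y}$ are compact, $\mathbb{E}[X]=0$, and $\Sigma_X=\mathbb{E}[XX^\top]$ is invertible, with smallest eigenvalue $\underline\lambda$. Put $c(u,y)=\|u-y\|^2/2$ and $$D(f,g,h)=\int f\,d\mu+\int h\,d\nu-\varepsilon\Big(\int e^{(f(u)+\langle g(u),x\rangle+h(x,y)-c(u,y))/\varepsilon}\,d(\mu\otimes\nu)(u,x,y)-1\Big).$$ *Dual potentials* are maximizers of $D$ over $L^1(\mu)\times L^1(\mu;\mathbb{R}^{d_x})\times L^1(\nu)$. A triplet $(f,g,h)$ is called *normalized* if $f,g$ are continuous on $\mathcal{U}$, $h$ is continuous on $\mathcal{X}\times\mathcal{Y}$, $\int f\,d\mu=0$ and $\int g\,d\mu=0$. **Sinkhorn algorithm for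 entropic vector quantile regression (VQR).** Start from a normalized triplet $(f^0,g^0,h^0)$. Given $(f^t,g^t,h^t)$, for each $u\in\mathcal{U}$ let $\tilde g^{t+1}(u)\in\mathbb{R}^{d_x}$ solve $$\int x\, e^{(\langle\tilde g^{t+1}(u),x\rangle+h^t(x,y)-c(u,y))/\varepsilon}\,d\nu(x,y)=0,$$ and set, for $u\in\mathcal U$ and $(x,y)\in\mathcal X\times\mathcal Y$, $$\tilde f^{t+1}(u)=-\varepsilon\log\int e^{(\langle\tilde g^{t+1}(u),x\rangle+h^t(x,y)-c(u,y))/\varepsilon}\,d\nu(x,y),$$ $$\tilde h^{t+1}(x,y)=-\varepsilon\log\int e^{(\tilde f^{t+1}(u)+\langle\tilde g^{t+1}(u),x\rangle-c(u,y))/\varepsilon}\,d\mu(u).$$ Finally put $f^{t+1}=\tilde f^{t+1}-\int\tilde f^{t+1}d\mu$, $g^{t+1}=\tilde g^{t+1}-\int\tilde g^{t+1}d\mu$ and $h^{t+1}(x,y)=\tilde h^{t+1}(x,y)+\int\tilde f^{t+1}d\mu+\langle\int\tilde g^{t+1}d\mu,x\rangle$. **Constants.** Let $\|\cdot\|_\infty$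 denote the supremum over $\mathcal{U}$, $\mathcal{X}\times\mathcal{Y}$ or $\mathcal{U}\times\mathcal{Y}$, as appropriate, let $\|\cdot\|_{\mathrm{op}}$ be the operator norm, and let $D_0=D(f^0,g^0,h^0)$, $D_0^-=\max\{-D_0,0\}$, $m_x=\sup_{x\in\mathcal{X}}\|x\|$, $L_c=\sup_{y\in\mathcal{Y}}\|y\|+\sup_{u\in\mathcal{U}}\|u\|$, $$k_f=L_c\operatorname{diam}(\mathcal{U})+\|c\|_\infty+D_0^-+\|h^0\|_\infty,$$ $$k_g=4\|\Sigma_X^{-1}\|_{\mathrm{op}}\,m_x\Big(4\|c\|_\infty-\tfrac32D_0+k_f+\|h^0\|_\infty+\varepsilon\log\tfrac32\Big),\qquad k_h=\|c\|_\infty+k_f+k_g m_x .$$ **Theorem.** Let $(\bar f,\bar g,\bar h)$ be a normalized triplet of dual potentials, and let $(f^t,g^t,h^t)_{t\ge0}$ be iterates of the Sinkhorn algorithm. Let $M_x,K_f,K_g,K_h$ be any real numbers with $M_x\ge\max\{1,m_x\}$, $K_f\ge\max\{k_f,\|\bar f\|_\infty,\|f^0\|_\infty\}$, $K_g\ge\max\{k_g,\|\bar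 g\|_\infty,\|g^0\|_\infty\}$, $K_h\ge\max\{k_h,\|\bar h\|_\infty,\|h^0\|_\infty\}$, and put $$\bar K=K_f+K_gM_x+K_h+\|c\|_\infty,\qquad \tau=\frac{(1\wedge\underline\lambda)^2e^{-5\bar K/\varepsilon}}{3M_x^2}.$$ Then all iterates $(f^t,g^t,h^t)$ are normalized triplets, $\tau>0$, and for every $t\in\{0,1,2,\dots\}$ $$D(\bar f,\bar g,\bar h)-D(f^t,g^t,h^t)\le(1+\tau)^{-t}\big(D(\bar f,\bar g,\bar h)-D_0\big).$$ Moreover, as $t\to\infty$, $$\|f^t-\bar f\|_{L^2(\mu)}^2+\|g^t-\bar g\|_{L^2(\mu)}^2+\|h^t-\bar h\|_{L^2(\nu)}^2=O\big((1+\tau)^{-t}\big).$$ -/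

import Mathlib

open MeasureTheory Filter Topology Asymptotics

noncomputable section

namespace VQR

/-- Euclidean space of dimension `n`. -/
abbrev E (n : ℕ) : Type := EuclideanSpace ℝ (Fin n)

variable {dx dy : ℕ}

/-- The quadratic ground cost `c(u,y) = ‖u - y‖² / 2`. -/
def cost (u y : E dy) : ℝ := ‖u - y‖ ^ 2 / 2

/-- The support `𝒳` of the covariate `X`, when `(X, Y)` has law `ν`. -/
def suppX (ν : Measure (E dx × E dy)) : Set (E dx) := (ν.map Prod.fst).support

/-- The support `𝒴` of the response `Y`, when `(X, Y)` has law `ν`. -/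
def suppY (ν : Measure (E dx × E dy)) : Set (E dy) := (ν.map Prod.snd).support

/-- The matrix `Σ_X = 𝔼[X Xᵀ]`. -/
def covX (ν : Measure (E dx × E dy)) : Matrix (Fin dx) (Fin dx) ℝ :=
  Matrix.of fun i j => ∫ p, p.1 i * p.1 j ∂ν

/-- The standing assumption: compact supports, `𝔼[X] = 0`, and `Σ_X` invertible. -/
structure StandingAssumption (μ : Measure (E dy)) (ν : Measure (E dx × E dy)) : Prop where
  compact_U : IsCompact μ.support
  compact_X : IsCompact (suppX ν)
  compact_Y : IsCompact (suppY ν)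
  mean_zero : ∫ p, p.1 ∂ν = 0
  cov_invertible : IsUnit (covX ν)

/-- The function `exp ((f(u) + ⟨g(u), x⟩ + h(x,y) - c(u,y)) / ε)` of `(u, (x, y))`. -/
def gibbs (ε : ℝ) (f : E dy → ℝ) (g : E dy → E dx) (h : E dx × E dy → ℝ)
    (q : E dy × (E dx × E dy)) : ℝ :=
  Real.exp ((f q.1 + inner ℝ (g q.1) q.2.1 + h q.2 - cost q.1 q.2.2) / ε)

/-- `ι(f,g,h)`, the integral of `gibbs` against `μ ⊗ ν` (to be used where it is finite). -/
def iota (ε : ℝ) (μ : Measure (E dy)) (ν : Measure (E dx × E dy))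
    (f : E dy → ℝ) (g : E dy → E dx) (h : E dx × E dy → ℝ) : ℝ :=
  ∫ q, gibbs ε f g h q ∂(μ.prod ν)

/-- The dual objective `D(f,g,h) = ∫ f dμ + ∫ h dν - ε (ι(f,g,h) - 1)`. -/
def dualObj (ε : ℝ) (μ : Measure (E dy)) (ν : Measure (E dx × E dy))
    (f : E dy → ℝ) (g : E dy → E dx) (h : E dx × E dy → ℝ) : ℝ :=
  ∫ u, f u ∂μ + ∫ p, h p ∂ν - ε * (iota ε μ ν f g h - 1)

/-- The triplets in `L¹(μ) × L¹(μ; ℝ^dx) × L¹(ν)` at which the dual objective is finite, that is,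
`ι(f,g,h) < ∞`. At all other triplets of `L¹` functions the dual objective is `-∞`. -/
structure InDualDomain (ε : ℝ) (μ : Measure (E dy)) (ν : Measure (E dx × E dy))
    (f : E dy → ℝ) (g : E dy → E dx) (h : E dx × E dy → ℝ) : Prop where
  int_f : Integrable f μ
  int_g : Integrable g μ
  int_h : Integrable h ν
  int_gibbs : Integrable (gibbs ε f g h) (μ.prod ν)

/-- Dual potentials: maximizers of the dual objective over `L¹(μ) × L¹(μ; ℝ^dx) × L¹(ν)`. Triplets
with `ι = ∞`, where the objective is `-∞`, cannot be maximizers and need not be compared with. -/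
structure IsDualPotential (ε : ℝ) (μ : Measure (E dy)) (ν : Measure (E dx × E dy))
    (f : E dy → ℝ) (g : E dy → E dx) (h : E dx × E dy → ℝ) : Prop where
  mem : InDualDomain ε μ ν f g h
  le_max : ∀ (f₁ : E dy → ℝ) (g₁ : E dy → E dx) (h₁ : E dx × E dy → ℝ),
    InDualDomain ε μ ν f₁ g₁ h₁ → dualObj ε μ ν f₁ g₁ h₁ ≤ dualObj ε μ ν f g h

/-- Membership in `C_⋄(𝒰) × C_⋄(𝒰; ℝ^dx) × C(𝒳 × 𝒴)`, where `⋄` means `μ`-mean zero. Functions are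
total; only their restrictions to the supports matter. -/
structure IsNormalized (μ : Measure (E dy)) (ν : Measure (E dx × E dy))
    (f : E dy → ℝ) (g : E dy → E dx) (h : E dx × E dy → ℝ) : Prop where
  cont_f : ContinuousOn f μ.support
  cont_g : ContinuousOn g μ.support
  cont_h : ContinuousOn h (suppX ν ×ˢ suppY ν)
  mean_f : ∫ u, f u ∂μ = 0
  mean_g : ∫ u, g u ∂μ = 0

/-- `(f t, g t, h t)`, `t = 0, 1, 2, …`, are iterates of the Sinkhorn algorithm; `ft t, gt t, ht t`
(for `t ≥ 1`) are the intermediate iterates before normalization. -/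
structure IsSinkhorn (ε : ℝ) (μ : Measure (E dy)) (ν : Measure (E dx × E dy))
    (f : ℕ → E dy → ℝ) (g : ℕ → E dy → E dx) (h : ℕ → E dx × E dy → ℝ)
    (ft : ℕ → E dy → ℝ) (gt : ℕ → E dy → E dx) (ht : ℕ → E dx × E dy → ℝ) : Prop where
  init : IsNormalized μ ν (f 0) (g 0) (h 0)
  /-- the implicit equation, solved exactly -/
  step_g : ∀ t, ∀ u ∈ μ.support,
    ∫ p, Real.exp ((inner ℝ (gt (t + 1) u) p.1 + h t p - cost u p.2) / ε) • p.1 ∂ν = 0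
  step_f : ∀ t, ∀ u ∈ μ.support,
    ft (t + 1) u = -ε * Real.log
      (∫ p, Real.exp ((inner ℝ (gt (t + 1) u) p.1 + h t p - cost u p.2) / ε) ∂ν)
  step_h : ∀ t, ∀ p ∈ suppX ν ×ˢ suppY ν,
    ht (t + 1) p = -ε * Real.log
      (∫ u, Real.exp ((ft (t + 1) u + inner ℝ (gt (t + 1) u) p.1 - cost u p.2) / ε) ∂μ)
  norm_f : ∀ t, ∀ u ∈ μ.support, f (t + 1) u = ft (t + 1) u - ∫ v, ft (t + 1) v ∂μ
  norm_g : ∀ t, ∀ u ∈ μ.support, g (t + 1) u = gt (t + 1) u - ∫ v, gt (t + 1) v ∂μ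
  norm_h : ∀ t, ∀ p ∈ suppX ν ×ˢ suppY ν,
    h (t + 1) p = ht (t + 1) p + ∫ v, ft (t + 1) v ∂μ + inner ℝ (∫ v, gt (t + 1) v ∂μ) p.1

/-- The supremum of `‖φ‖` over a set `S` (for `φ` bounded on the nonempty set `S`). -/
def supNorm {α F : Type*} [Norm F] (S : Set α) (φ : α → F) : ℝ := ⨆ a : S, ‖φ a‖

/-- `M_x = sup_{x ∈ 𝒳} ‖x‖`. -/
def Mx (ν : Measure (E dx × E dy)) : ℝ := supNorm (suppX ν) (fun x => x)

/-- `‖c‖_∞`, the supremum of the cost over `𝒰 × 𝒴`. -/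
def costSup (μ : Measure (E dy)) (ν : Measure (E dx × E dy)) : ℝ :=
  supNorm (μ.support ×ˢ suppY ν) (fun p : E dy × E dy => cost p.1 p.2)

/-- `L_c = sup_{y ∈ 𝒴} ‖y‖ + sup_{u ∈ 𝒰} ‖u‖`. -/
def Lc (μ : Measure (E dy)) (ν : Measure (E dx × E dy)) : ℝ :=
  supNorm (suppY ν) (fun y => y) + supNorm μ.support (fun u => u)

/-- The smallest eigenvalue of `Σ_X`. -/
def lamMin (ν : Measure (E dx × E dy)) : ℝ := sInf (spectrum ℝ (covX ν))

/-- The operator norm of `Σ_X⁻¹` for the Euclidean norm. -/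
def covInvNorm (ν : Measure (E dx × E dy)) : ℝ :=
  ‖Matrix.toEuclideanCLM (𝕜 := ℝ) (covX ν)⁻¹‖

/-- `L_c diam(𝒰) + ‖c‖_∞ + D₀⁻ + ‖h⁰‖_∞`, with `D₀ = D(f⁰,g⁰,h⁰)`. -/
def boundF (ε : ℝ) (μ : Measure (E dy)) (ν : Measure (E dx × E dy))
    (f₀ : E dy → ℝ) (g₀ : E dy → E dx) (h₀ : E dx × E dy → ℝ) : ℝ :=
  Lc μ ν * Metric.diam μ.support + costSup μ ν + max (-dualObj ε μ ν f₀ g₀ h₀) 0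
    + supNorm (suppX ν ×ˢ suppY ν) h₀

/-- `4 ‖Σ_X⁻¹‖ M_x (4 ‖c‖_∞ - (3/2) D₀ + boundF + ‖h⁰‖_∞ + ε log (3/2))`. -/
def boundG (ε : ℝ) (μ : Measure (E dy)) (ν : Measure (E dx × E dy))
    (f₀ : E dy → ℝ) (g₀ : E dy → E dx) (h₀ : E dx × E dy → ℝ) : ℝ :=
  4 * covInvNorm ν * Mx ν *
    (4 * costSup μ ν - 3 / 2 * dualObj ε μ ν f₀ g₀ h₀ + boundF ε μ ν f₀ g₀ h₀
      + supNorm (suppX ν ×ˢ suppY ν) h₀ + ε * Real.log (3 / 2))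

/-- `‖c‖_∞ + boundF + boundG * M_x`. -/
def boundH (ε : ℝ) (μ : Measure (E dy)) (ν : Measure (E dx × E dy))
    (f₀ : E dy → ℝ) (g₀ : E dy → E dx) (h₀ : E dx × E dy → ℝ) : ℝ :=
  costSup μ ν + boundF ε μ ν f₀ g₀ h₀ + boundG ε μ ν f₀ g₀ h₀ * Mx ν

/-- The rate `τ = (1 ∧ λ)² exp(-5 K̄ / ε) / (3 M²)` with `K̄ = K_f + K_g M + K_h + ‖c‖_∞` and `λ`
the smallest eigenvalue of `Σ_X`. -/
def rate (ε : ℝ) (μ : Measure (E dy)) (ν : Measure (E dx × E dy)) (M Kf Kg Kh : ℝ) : ℝ :=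
  (min 1 (lamMin ν)) ^ 2 * Real.exp (-5 * (Kf + Kg * M + Kh + costSup μ ν) / ε) / (3 * M ^ 2)

end VQR

end

noncomputable section

set_option linter.unusedSectionVars false

namespace VQR

/-! ### Scalar inequalities for the exponential -/

section Inequalities

/-! Sinkhorn is block ascent on a concave functional: one block is `(f, g)`, the other is `h`, and
normalization does not change the objective because `X` is centered. The rate comes from an estimate
"gap after a step ≤ Q · increment of the step", which yields geometric decay
(`le_inv_pow_mul_of_le_mul_sub`).

For the estimate (`dualOn_sub_le_increment`), let `e₀` be the Gibbs density after the `(f, g)`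
update and `e₁` the density after the `h` update, and let `(φ, γ, η)` be the displacement to the
dual potentials. Strong convexity of the exponential bounds the gap by a first-order term minus a
quadratic term. In the first-order term `η` cancels, since `h` has just been optimized. What remains
is the integral of `(e₀ - e₁)(φ + ⟨γ, X⟩)`, because `e₀` satisfies the first-order conditions in
`(f, g)`. A Young inequality for relative entropy (`sub_one_mul_le_entropy`) splits it into a
multiple of the entropy of `e₀` relative to `e₁`, which is exactly the increment divided by `ε`, and
a quadratic remainder. The remainder is absorbed by the strong convexity term, which is coercive on
centered directions since `Σ_X` is positive definite (`le_integral_sq`).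

This requires uniform bounds on the iterates. Each `f` inherits the Lipschitz constant of the cost,
and is centered. Jensen gives `h ≤ ‖c‖_∞`, and monotonicity of the objective bounds the negative
part of `h` in `L¹`; together these bound the critical point `g` (`norm_le_of_critical`). Optimality
of `h` then bounds `h` itself.

The `L²` statement is quadratic growth of the gap (`sq_dist_le_dualOn_sub`). Everything is proved on
compact spaces and transferred to the supports. -/

lemma sq_half_le_mul_exp {y : ℝ} (hy : 0 ≤ y) : y ^ 2 / 2 ≤ 1 - Real.exp y + y * Real.exp y := by
  have hd : ∀ x : ℝ, HasDerivAt (fun x : ℝ => 1 - Real.exp x + x * Real.exp x - x ^ 2 / 2)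
      (x * Real.exp x - x) x := by
    intro x
    have h1 := (((hasDerivAt_const x (1 : ℝ)).sub (Real.hasDerivAt_exp x)).add
      ((hasDerivAt_id x).mul (Real.hasDerivAt_exp x))).sub ((hasDerivAt_pow 2 x).div_const 2)
    refine h1.congr_deriv ?_
    simp only [id, Nat.cast_ofNat]
    ring
  have hm : MonotoneOn (fun x : ℝ => 1 - Real.exp x + x * Real.exp x - x ^ 2 / 2) (Set.Ici 0) := by
    refine monotoneOn_of_deriv_nonneg (convex_Ici 0)
      (fun x _ => (hd x).continuousAt.continuousWithinAt)
      (fun x _ => (hd x).differentiableAt.differentiableWithinAt) fun x hx => ?_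
    rw [interior_Ici] at hx
    have hx : 0 < x := hx
    rw [(hd x).deriv]
    nlinarith [Real.add_one_le_exp x]
  have := hm (Set.mem_Ici.2 le_rfl) (Set.mem_Ici.2 hy) hy
  simp at this
  linarith

/-- Strong convexity of the exponential where it is bounded below by `k`. -/
lemma exp_strongConvex {k a b : ℝ} (ha : k ≤ Real.exp a) (hb : k ≤ Real.exp b) :
    Real.exp a + Real.exp a * (b - a) + k / 2 * (b - a) ^ 2 ≤ Real.exp b := by
  -- In either case the smaller of the two exponentials is factored out, since the constant `k` has
  -- to be charged to it.
  rcases le_total a b with hab | hab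
  · have h1 := Real.quadratic_le_exp_of_nonneg (sub_nonneg.2 hab)
    have h2 : Real.exp b = Real.exp a * Real.exp (b - a) := by rw [← Real.exp_add]; ring_nf
    rw [h2]
    have := mul_le_mul_of_nonneg_left h1 (Real.exp_pos a).le
    nlinarith [mul_le_mul_of_nonneg_right ha (sq_nonneg (b - a))]
  · have h1 := sq_half_le_mul_exp (sub_nonneg.2 hab)
    have h2 : Real.exp a = Real.exp b * Real.exp (a - b) := by rw [← Real.exp_add]; ring_nf
    have := mul_le_mul_of_nonneg_left h1 (Real.exp_pos b).le
    rw [h2]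
    nlinarith [mul_le_mul_of_nonneg_right hb (sq_nonneg (a - b))]

lemma exp_strongConvex_div {ε k a b : ℝ} (hε : 0 < ε) (ha : k ≤ Real.exp (a / ε))
    (hb : k ≤ Real.exp (b / ε)) :
    ε * Real.exp (a / ε) + Real.exp (a / ε) * (b - a) + k / (2 * ε) * (b - a) ^ 2
      ≤ ε * Real.exp (b / ε) := by
  have h := mul_le_mul_of_nonneg_left (exp_strongConvex ha hb) hε.le
  refine le_of_eq_of_le ?_ h
  field_simp

lemma exp_tangent_div {ε : ℝ} (hε : 0 < ε) (a b : ℝ) :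
    ε * Real.exp (a / ε) + Real.exp (a / ε) * (b - a) ≤ ε * Real.exp (b / ε) := by
  simpa using exp_strongConvex_div hε (Real.exp_pos (a / ε)).le (Real.exp_pos (b / ε)).le

lemma exp_strongMonotone_div {ε k a b : ℝ} (hε : 0 < ε) (ha : k ≤ Real.exp (a / ε))
    (hb : k ≤ Real.exp (b / ε)) :
    k / ε * (b - a) ^ 2 ≤ (Real.exp (b / ε) - Real.exp (a / ε)) * (b - a) := by
  have h1 := exp_strongConvex_div hε ha hb
  have h2 := exp_strongConvex_div hε hb ha
  have h3 : k / ε * (b - a) ^ 2 = k / (2 * ε) * (b - a) ^ 2 + k / (2 * ε) * (a - b) ^ 2 := by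
    field_simp; ring
  rw [h3]; linarith

/-- Expand at the midpoint towards both ends: the linear terms cancel. No derivative of the
objective at a maximizer is then needed later, only a comparison of values. -/
lemma exp_midpoint_div {ε k a b : ℝ} (hε : 0 < ε) (ha : k ≤ Real.exp (a / ε))
    (hb : k ≤ Real.exp (b / ε)) :
    ε * Real.exp ((a + b) / 2 / ε) + k / (8 * ε) * (b - a) ^ 2
      ≤ (ε * Real.exp (a / ε) + ε * Real.exp (b / ε)) / 2 := by
  have hc : k ≤ Real.exp ((a + b) / 2 / ε) := by
    rcases le_total a b with hab | hab
    · exact ha.trans (Real.exp_le_exp.2 (by gcongr; linarith))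
    · exact hb.trans (Real.exp_le_exp.2 (by gcongr; linarith))
  have h1 := exp_strongConvex_div hε hc ha
  have h2 := exp_strongConvex_div hε hc hb
  have h3 : k / (8 * ε) * (b - a) ^ 2 = (k / (2 * ε) * (a - (a + b) / 2) ^ 2
      + k / (2 * ε) * (b - (a + b) / 2) ^ 2) / 2 := by field_simp; ring
  rw [h3]; linarith

lemma abs_exp_div_sub_le {ε k a b : ℝ} (hε : 0 < ε) (ha : Real.exp (a / ε) ≤ k)
    (hb : Real.exp (b / ε) ≤ k) :
    |Real.exp (b / ε) - Real.exp (a / ε)| ≤ k / ε * |b - a| := by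
  wlog hab : a ≤ b generalizing a b
  · rw [abs_sub_comm, abs_sub_comm b]; exact this hb ha (not_le.1 hab).le
  have h := exp_tangent_div hε b a
  have h0 : Real.exp (a / ε) ≤ Real.exp (b / ε) := Real.exp_le_exp.2 (by gcongr)
  rw [abs_of_nonneg (by linarith), abs_of_nonneg (by linarith), div_mul_eq_mul_div, le_div_iff₀ hε]
  nlinarith [mul_le_mul_of_nonneg_right hb (sub_nonneg.2 hab)]

/-- A Young inequality adapted to relative entropies. -/
lemma sub_one_mul_le_entropy {β w : ℝ} (hβ : 0 < β) (hw : 0 < w) (s : ℝ) :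
    (w - 1) * s ≤ β / 2 * (w - 1 - Real.log w) + (w + 1) * s ^ 2 / β := by
  -- With `w = r ^ 2` the entropy dominates the Hellinger term `(r - 1) ^ 2`, while `w - 1 = (r - 1)
  -- * (r + 1)` and `(r + 1) ^ 2 ≤ 2 * (r ^ 2 + 1)`, so that the ordinary Young inequality applies.
  obtain ⟨r, hr, rfl⟩ : ∃ r : ℝ, 0 < r ∧ w = r ^ 2 :=
    ⟨√w, Real.sqrt_pos.2 hw, (Real.sq_sqrt hw.le).symm⟩
  have h1 : (r - 1) ^ 2 ≤ r ^ 2 - 1 - Real.log (r ^ 2) := by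
    rw [Real.log_pow]
    have := Real.log_le_sub_one_of_pos hr
    push_cast
    nlinarith
  have h2 : (r ^ 2 - 1) * s ≤ β / 2 * (r - 1) ^ 2 + (r ^ 2 + 1) * s ^ 2 / β := by
    have h3 : (r + 1) ^ 2 * s ^ 2 ≤ 2 * ((r ^ 2 + 1) * s ^ 2) := by
      nlinarith [mul_nonneg (sq_nonneg (r - 1)) (sq_nonneg s)]
    rw [← sub_le_iff_le_add', le_div_iff₀ hβ]
    nlinarith [sq_nonneg (β * (r - 1) - (r + 1) * s)]
  have := mul_le_mul_of_nonneg_left h1 (half_pos hβ).le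
  linarith

/-- The argument in `norm_le_of_critical` produces the constant `exp (-1)`, whereas `boundG` is
stated with `log (3 / 2)`. -/
lemma exp_neg_one_le_log : Real.exp (-1) ≤ Real.log (3 / 2) := by
  have h1 : Real.exp (-1) ≤ 0.368 := by
    rw [Real.exp_neg, inv_le_comm₀ (Real.exp_pos 1) (by norm_num)]
    have := Real.exp_one_gt_d9
    norm_num at *
    linarith
  have h2 : (0.4 : ℝ) ≤ Real.log (3 / 2) := by
    rw [Real.le_log_iff_exp_le (by norm_num)]
    have h5 : Real.exp 0.4 ^ 5 = Real.exp 1 ^ 2 := by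
      rw [← Real.exp_nat_mul, ← Real.exp_nat_mul]; norm_num
    have h6 : Real.exp 1 ^ 2 ≤ (3 / 2 : ℝ) ^ 5 := by
      have := Real.exp_one_lt_d9
      have := Real.exp_pos 1
      nlinarith
    exact le_of_pow_le_pow_left₀ (n := 5) (by norm_num) (by norm_num) (h5 ▸ h6)
  linarith

end Inequalities

/-! ### Integrals of continuous functions on compact spaces -/

lemma _root_.Continuous.integrable_of_compactSpace {α F : Type*} [TopologicalSpace α]
    [CompactSpace α] [MeasurableSpace α] [OpensMeasurableSpace α] [NormedAddCommGroup F]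
    {m : Measure α} [IsFiniteMeasure m] {φ : α → F} (hφ : Continuous φ) : Integrable φ m :=
  hφ.integrable_of_hasCompactSupport (HasCompactSupport.of_compactSpace φ)

lemma _root_.Continuous.integral_prod_left {α β F : Type*} [TopologicalSpace α] [TopologicalSpace β]
    [FirstCountableTopology α] [CompactSpace α] [CompactSpace β] [MeasurableSpace β]
    [OpensMeasurableSpace β] [SecondCountableTopology β]
    [NormedAddCommGroup F] [NormedSpace ℝ F] {n : Measure β} [IsFiniteMeasure n]
    {φ : α × β → F} (hφ : Continuous φ) : Continuous fun a => ∫ b, φ (a, b) ∂n := by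
  obtain ⟨C, hC⟩ := isCompact_univ.exists_bound_of_continuousOn hφ.continuousOn
  refine continuous_of_dominated (bound := fun _ => C) (fun a => ?_) (fun a => ?_)
    (integrable_const _) ?_
  · exact (by fun_prop : Continuous fun b => φ (a, b)).aestronglyMeasurable
  · exact Eventually.of_forall fun b => hC _ (Set.mem_univ _)
  · exact Eventually.of_forall fun b => by fun_prop

section

/-- `φ` is integrable with integral `r`. -/
structure HasIntegral {α F : Type*} [MeasurableSpace α] [NormedAddCommGroup F] [NormedSpace ℝ F]
    (m : Measure α) (φ : α → F) (r : F) : Prop where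
  integrable : Integrable φ m
  integral_eq : ∫ a, φ a ∂m = r

namespace HasIntegral

variable {α : Type*} [MeasurableSpace α] {m : Measure α} {φ ψ : α → ℝ} {r s : ℝ}

lemma add (h : HasIntegral m φ r) (k : HasIntegral m ψ s) :
    HasIntegral m (fun a => φ a + ψ a) (r + s) :=
  ⟨h.1.add k.1, by rw [integral_add h.1 k.1, h.2, k.2]⟩

lemma sub (h : HasIntegral m φ r) (k : HasIntegral m ψ s) :
    HasIntegral m (fun a => φ a - ψ a) (r - s) :=
  ⟨h.1.sub k.1, by rw [integral_sub h.1 k.1, h.2, k.2]⟩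

lemma const_mul (h : HasIntegral m φ r) (k : ℝ) : HasIntegral m (fun a => k * φ a) (k * r) :=
  ⟨h.1.const_mul k, by rw [integral_const_mul, h.2]⟩

lemma mono (h : HasIntegral m φ r) (k : HasIntegral m ψ s) (hle : ∀ a, φ a ≤ ψ a) : r ≤ s := by
  rw [← h.2, ← k.2]; exact integral_mono h.1 k.1 hle

lemma congr (h : HasIntegral m φ r) (hψ : ∀ a, ψ a = φ a) (hs : s = r) : HasIntegral m ψ s := by
  rw [funext hψ, hs]; exact h

end HasIntegral

lemma _root_.Continuous.hasIntegral {α F : Type*} [TopologicalSpace α]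
    [CompactSpace α] [MeasurableSpace α] [OpensMeasurableSpace α] [NormedAddCommGroup F]
    [NormedSpace ℝ F] {m : Measure α} [IsFiniteMeasure m] {φ : α → F} (hφ : Continuous φ) :
    HasIntegral m φ (∫ a, φ a ∂m) :=
  ⟨hφ.integrable_of_compactSpace, rfl⟩

/-! ### The dual objective on compact spaces, and the gap against the increment -/

/-- The function `f(u) + ⟨g(u), X(s)⟩ + h(s) - c(u,s)`. -/
def slack {U S V : Type*} [NormedAddCommGroup V] [InnerProductSpace ℝ V] (X : S → V)
    (c : U × S → ℝ) (f : U → ℝ) (g : U → V) (h : S → ℝ) (q : U × S) : ℝ :=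
  f q.1 + inner ℝ (g q.1) (X q.2) + h q.2 - c q

lemma slack_shift {U S V : Type*} [NormedAddCommGroup V] [InnerProductSpace ℝ V]
    {X : S → V} {c : U × S → ℝ} (f : U → ℝ) (g : U → V)
    (h : S → ℝ) (a : ℝ) (b : V) :
    slack X c (fun u => f u - a) (fun u => g u - b) (fun s => h s + a + inner ℝ b (X s))
      = slack X c f g h := by
  funext q
  simp only [slack, inner_sub_left]; ring

lemma abs_slack_le {U S V : Type*} [NormedAddCommGroup V] [InnerProductSpace ℝ V]
    {X : S → V} {c : U × S → ℝ} {f : U → ℝ} {g : U → V} {h : S → ℝ}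
    {F G H M C : ℝ} (hf : ∀ u, |f u| ≤ F) (hg : ∀ u, ‖g u‖ ≤ G) (hh : ∀ s, |h s| ≤ H)
    (hX : ∀ s, ‖X s‖ ≤ M) (hc0 : ∀ q, 0 ≤ c q) (hc : ∀ q, c q ≤ C) (q : U × S) :
    |slack X c f g h q| ≤ F + G * M + H + C := by
  have h1 : |inner ℝ (g q.1) (X q.2)| ≤ G * M :=
    (abs_real_inner_le_norm _ _).trans (mul_le_mul (hg _) (hX _) (norm_nonneg _)
      ((norm_nonneg _).trans (hg q.1)))
  have h2 := hf q.1
  have h3 := hh q.2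
  have h4 := hc0 q
  have h5 := hc q
  unfold slack
  rw [abs_le] at *
  constructor <;> linarith

@[fun_prop]
lemma continuous_slack {U S V : Type*} [TopologicalSpace U] [TopologicalSpace S]
    [NormedAddCommGroup V] [InnerProductSpace ℝ V]
    {X : S → V} {c : U × S → ℝ} {f : U → ℝ} {g : U → V} {h : S → ℝ}
    (hX : Continuous X) (hc : Continuous c) (hf : Continuous f) (hg : Continuous g)
    (hh : Continuous h) : Continuous (slack X c f g h) := by
  unfold slack; fun_prop

variable {U S V : Type*} [TopologicalSpace U] [CompactSpace U] [SecondCountableTopology U]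
  [MeasurableSpace U] [BorelSpace U] [TopologicalSpace S] [CompactSpace S]
  [SecondCountableTopology S] [MeasurableSpace S] [BorelSpace S]
  [NormedAddCommGroup V] [InnerProductSpace ℝ V] [CompleteSpace V]

/-- The dual objective of vector quantile regression with covariate `X` and cost `c`. -/
def dualOn (ε : ℝ) (m : Measure U) (n : Measure S) (X : S → V) (c : U × S → ℝ)
    (f : U → ℝ) (g : U → V) (h : S → ℝ) : ℝ :=
  ∫ u, f u ∂m + ∫ s, h s ∂n
    - ε * (∫ q, Real.exp (slack X c f g h q / ε) ∂(m.prod n) - 1)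

/-- A bounded centered covariate whose second moments are bounded below by `lam`. -/
structure IsCovariate (n : Measure S) (X : S → V) (lam M : ℝ) : Prop where
  cont : Continuous X
  mean_zero : ∫ s, X s ∂n = 0
  lam_pos : 0 < lam
  coercive : ∀ v, lam * ‖v‖ ^ 2 ≤ ∫ s, inner ℝ v (X s) ^ 2 ∂n
  bound : ∀ s, ‖X s‖ ≤ M

variable {m : Measure U} {n : Measure S} [IsProbabilityMeasure m] [IsProbabilityMeasure n]

lemma hasIntegral_fst {φ : U → ℝ} (hφ : Continuous φ) :
    HasIntegral (m.prod n) (fun q => φ q.1) (∫ u, φ u ∂m) :=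
  ⟨Continuous.integrable_of_compactSpace (by fun_prop), by simp [integral_fun_fst]⟩

lemma hasIntegral_snd {φ : S → ℝ} (hφ : Continuous φ) :
    HasIntegral (m.prod n) (fun q => φ q.2) (∫ u, φ u ∂n) :=
  ⟨Continuous.integrable_of_compactSpace (by fun_prop), by simp [integral_fun_snd]⟩

lemma hasIntegral_inner {γ : U → V} {Y : S → V} (hγ : Continuous γ) (hY : Continuous Y) :
    HasIntegral (m.prod n) (fun q => inner ℝ (γ q.1) (Y q.2))
      (inner ℝ (∫ u, γ u ∂m) (∫ s, Y s ∂n)) := by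
  have hi : Integrable (fun q : U × S => inner ℝ (γ q.1) (Y q.2)) (m.prod n) :=
    Continuous.integrable_of_compactSpace (by fun_prop)
  refine ⟨hi, ?_⟩
  rw [integral_prod _ hi]
  simp_rw [integral_inner hY.integrable_of_compactSpace, real_inner_comm (∫ s, Y s ∂n)]
  rw [integral_inner hγ.integrable_of_compactSpace]

lemma hasIntegral_mul_fst {e : U × S → ℝ} (he : Continuous e) (h1 : ∀ u, ∫ s, e (u, s) ∂n = 1)
    {φ : U → ℝ} (hφ : Continuous φ) :
    HasIntegral (m.prod n) (fun q => e q * φ q.1) (∫ u, φ u ∂m) := by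
  have hi : Integrable (fun q : U × S => e q * φ q.1) (m.prod n) :=
    Continuous.integrable_of_compactSpace (by fun_prop)
  refine ⟨hi, ?_⟩
  rw [integral_prod _ hi]
  simp [integral_mul_const, h1]

lemma hasIntegral_mul_snd {e : U × S → ℝ} (he : Continuous e) (h1 : ∀ s, ∫ u, e (u, s) ∂m = 1)
    {φ : S → ℝ} (hφ : Continuous φ) :
    HasIntegral (m.prod n) (fun q => e q * φ q.2) (∫ s, φ s ∂n) := by
  have hi : Integrable (fun q : U × S => e q * φ q.2) (m.prod n) :=
    Continuous.integrable_of_compactSpace (by fun_prop)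
  refine ⟨hi, ?_⟩
  rw [integral_prod_symm _ hi]
  simp [integral_mul_const, h1]

lemma hasIntegral_mul_inner {e : U × S → ℝ} (he : Continuous e) {X : S → V} (hX : Continuous X)
    (h1 : ∀ u, ∫ s, e (u, s) • X s ∂n = 0) {γ : U → V} (hγ : Continuous γ) :
    HasIntegral (m.prod n) (fun q => e q * inner ℝ (γ q.1) (X q.2)) 0 := by
  have hi : Integrable (fun q : U × S => e q * inner ℝ (γ q.1) (X q.2)) (m.prod n) :=
    Continuous.integrable_of_compactSpace (by fun_prop)
  refine ⟨hi, ?_⟩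
  rw [integral_prod _ hi]
  have : ∀ u, ∫ s, e (u, s) * inner ℝ (γ u) (X s) ∂n = 0 := fun u => by
    simp_rw [← real_inner_smul_right]
    have hi : Integrable (fun s => e (u, s) • X s) n :=
      Continuous.integrable_of_compactSpace (by fun_prop)
    rw [integral_inner hi, h1, inner_zero_right]
  simp [this]

/-- Coercivity of the second variation of the dual objective on normalized directions. -/
lemma le_integral_sq {X : S → V} {lam M : ℝ} (hX : IsCovariate n X lam M) {φ : U → ℝ} {γ : U → V}
    {η : S → ℝ} (hφ : Continuous φ) (hγ : Continuous γ) (hη : Continuous η)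
    (hφ0 : ∫ u, φ u ∂m = 0) (hγ0 : ∫ u, γ u ∂m = 0) :
    min 1 lam * (∫ u, φ u ^ 2 ∂m + ∫ u, ‖γ u‖ ^ 2 ∂m + ∫ s, η s ^ 2 ∂n) ≤
      ∫ q, (φ q.1 + inner ℝ (γ q.1) (X q.2) + η q.2) ^ 2 ∂(m.prod n) := by
  have hXc := hX.cont
  have i1 : HasIntegral (m.prod n) (fun q => φ q.1 ^ 2) (∫ u, φ u ^ 2 ∂m) :=
    hasIntegral_fst (φ := fun u => φ u ^ 2) (by fun_prop)
  have i2 : HasIntegral (m.prod n) (fun q => η q.2 ^ 2) (∫ s, η s ^ 2 ∂n) :=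
    hasIntegral_snd (φ := fun s => η s ^ 2) (by fun_prop)
  -- All three cross terms vanish under the product measure: this one because `X` is centered, `i4`
  -- because `γ` is, `i5` because `φ` is.
  have i3 : HasIntegral (m.prod n) (fun q => φ q.1 * inner ℝ (γ q.1) (X q.2)) 0 :=
    (hasIntegral_inner (γ := fun u => φ u • γ u) (by fun_prop) hXc).congr
      (fun q => (real_inner_smul_left _ _ _).symm) (by simp [hX.mean_zero])
  have i4 : HasIntegral (m.prod n) (fun q => η q.2 * inner ℝ (γ q.1) (X q.2)) 0 :=
    (hasIntegral_inner (Y := fun s => η s • X s) hγ (by fun_prop)).congr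
      (fun q => (real_inner_smul_right _ _ _).symm) (by simp [hγ0])
  have i5 : HasIntegral (m.prod n) (fun q => φ q.1 * η q.2) 0 :=
    ⟨Continuous.integrable_of_compactSpace (by fun_prop), by rw [integral_prod_mul, hφ0, zero_mul]⟩
  have i6 : HasIntegral (m.prod n) (fun q => inner ℝ (γ q.1) (X q.2) ^ 2)
      (∫ u, ∫ s, inner ℝ (γ u) (X s) ^ 2 ∂n ∂m) := by
    have hi : Integrable (fun q : U × S => inner ℝ (γ q.1) (X q.2) ^ 2) (m.prod n) :=
      Continuous.integrable_of_compactSpace (by fun_prop)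
    exact ⟨hi, integral_prod _ hi⟩
  have hs := (((((i1.add i2).add i6).add (i3.const_mul 2)).add (i4.const_mul 2)).add
    (i5.const_mul 2)).congr
    (ψ := fun q => (φ q.1 + inner ℝ (γ q.1) (X q.2) + η q.2) ^ 2) (fun q => by ring) rfl
  rw [hs.2]
  have h6 : lam * ∫ u, ‖γ u‖ ^ 2 ∂m ≤ ∫ u, ∫ s, inner ℝ (γ u) (X s) ^ 2 ∂n ∂m := by
    rw [← integral_const_mul]
    refine integral_mono (Continuous.integrable_of_compactSpace (by fun_prop))
      (Continuous.integrable_of_compactSpace ?_) fun u => hX.coercive _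
    exact Continuous.integral_prod_left (φ := fun q : U × S => inner ℝ (γ q.1) (X q.2) ^ 2)
      (by fun_prop)
  have n1 : 0 ≤ ∫ u, φ u ^ 2 ∂m := integral_nonneg fun u => sq_nonneg _
  have n2 : 0 ≤ ∫ u, ‖γ u‖ ^ 2 ∂m := integral_nonneg fun u => sq_nonneg _
  have n3 : 0 ≤ ∫ s, η s ^ 2 ∂n := integral_nonneg fun u => sq_nonneg _
  nlinarith [mul_le_mul_of_nonneg_right (min_le_left 1 lam) n1,
    mul_le_mul_of_nonneg_right (min_le_left 1 lam) n3,
    mul_le_mul_of_nonneg_right (min_le_right 1 lam) n2]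

set_option maxHeartbeats 1000000 in
/-- The dual objective at an iterate of block ascent is controlled by the last increment. -/
theorem dualOn_sub_le_increment {ε : ℝ} (hε : 0 < ε) {X : S → V} {lam M K : ℝ}
    (hX : IsCovariate n X lam M) (hM : 1 ≤ M) {c : U × S → ℝ} (hc : Continuous c)
    {f f' : U → ℝ} {g g' : U → V} {h k h' : S → ℝ} (hf : Continuous f) (hg : Continuous g)
    (hh : Continuous h) (hk : Continuous k) (hf' : Continuous f') (hg' : Continuous g')
    (hh' : Continuous h')
    (opt_f : ∀ u, ∫ s, Real.exp (slack X c f g h (u, s) / ε) ∂n = 1)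
    (opt_g : ∀ u, ∫ s, Real.exp (slack X c f g h (u, s) / ε) • X s ∂n = 0)
    (opt_h : ∀ s, ∫ u, Real.exp (slack X c f g k (u, s) / ε) ∂m = 1)
    (hK : 0 ≤ K) (hZ : ∀ q, |slack X c f g k q| ≤ K) (hZ' : ∀ q, |slack X c f' g' h' q| ≤ K)
    (hf0 : ∫ u, (f' u - f u) ∂m = 0) (hg0 : ∫ u, (g' u - g u) ∂m = 0) :
    dualOn ε m n X c f' g' h' - dualOn ε m n X c f g k ≤
      2 * Real.exp (K / ε) ^ 2 * M ^ 2 / min 1 lam *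
        (dualOn ε m n X c f g k - dualOn ε m n X c f g h) := by
  have hXc := hX.cont
  set L := min 1 lam with hL
  have hLpos : 0 < L := lt_min one_pos hX.lam_pos
  set A := Real.exp (K / ε) with hA
  have hA1 : 1 ≤ A := Real.one_le_exp (by positivity)
  have hApos : 0 < A := by linarith
  set φ := fun u => f' u - f u with hφd
  set γ := fun u => g' u - g u with hγd
  set η := fun s => h' s - k s with hηd
  have hφ : Continuous φ := by fun_prop
  have hγ : Continuous γ := by fun_prop
  have hη : Continuous η := by fun_prop
  -- The Young parameter is chosen so that the remainder, at most `2 * A * M ^ 2 * (Φ + Γ) / β`,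
  -- equals `A⁻¹ / (2 * ε) * L * (Φ + Γ)`, the part of the strong convexity term supplied by
  -- coercivity.
  set β := 4 * ε * A ^ 2 * M ^ 2 / L with hβd
  have hβ : 0 < β := by positivity
  set e₀ := fun q => Real.exp (slack X c f g h q / ε) with he₀
  set e₁ := fun q => Real.exp (slack X c f g k q / ε) with he₁
  set e₂ := fun q => Real.exp (slack X c f' g' h' q / ε) with he₂
  have ce₀ : Continuous e₀ := by fun_prop
  have ce₁ : Continuous e₁ := by fun_prop
  have ce₂ : Continuous e₂ := by fun_prop
  have lower : ∀ z : ℝ, |z| ≤ K → A⁻¹ ≤ Real.exp (z / ε) := fun z hz => by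
    rw [hA, ← Real.exp_neg, ← neg_div]
    exact Real.exp_le_exp.2 (by gcongr; linarith [neg_abs_le z])
  have upper : ∀ z : ℝ, |z| ≤ K → Real.exp (z / ε) ≤ A := fun z hz =>
    Real.exp_le_exp.2 (by gcongr; linarith [le_abs_self z])
  -- the pointwise inequality
  have key : ∀ q : U × S, φ q.1 + η q.2 - ε * e₂ q + ε * e₁ q ≤
      (φ q.1 - e₀ q * φ q.1) + (η q.2 - e₁ q * η q.2) - e₀ q * inner ℝ (γ q.1) (X q.2)
      + β / 2 * (e₀ q - e₁ q - ε⁻¹ * (e₁ q * (h q.2 - k q.2)))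
      + β⁻¹ * ((e₀ q * (φ q.1 ^ 2 + M ^ 2 * ‖γ q.1‖ ^ 2)
          + e₀ q * inner ℝ ((2 * φ q.1) • γ q.1) (X q.2))
        + A * ((φ q.1 ^ 2 + M ^ 2 * ‖γ q.1‖ ^ 2) + inner ℝ ((2 * φ q.1) • γ q.1) (X q.2)))
      - A⁻¹ / (2 * ε) * (φ q.1 + inner ℝ (γ q.1) (X q.2) + η q.2) ^ 2 := by
    intro q
    have h1 := exp_strongConvex_div hε (lower _ (hZ q)) (lower _ (hZ' q))
    have hd : slack X c f' g' h' q - slack X c f g k q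
        = φ q.1 + inner ℝ (γ q.1) (X q.2) + η q.2 := by
      simp only [slack, hφd, hγd, hηd, inner_sub_left]; ring
    rw [hd] at h1
    -- `w` is the ratio `e₀ / e₁`; it depends on `q.2` only, and its logarithm is the update of `h`
    -- divided by `ε`.
    set w := Real.exp ((h q.2 - k q.2) / ε) with hw
    have hwe : e₀ q = e₁ q * w := by
      simp only [he₀, he₁, hw, ← Real.exp_add, slack]; congr 1; field_simp; ring
    set x := inner ℝ (γ q.1) (X q.2) with hx
    have h2 := sub_one_mul_le_entropy hβ (Real.exp_pos ((h q.2 - k q.2) / ε)) (φ q.1 + x)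
    rw [Real.log_exp, ← hw] at h2
    have he1 : 0 < e₁ q := Real.exp_pos _
    have he0 : 0 < e₀ q := Real.exp_pos _
    have h3 := mul_le_mul_of_nonneg_left h2 he1.le
    have hxx : x ^ 2 ≤ M ^ 2 * ‖γ q.1‖ ^ 2 := by
      rw [← mul_pow, sq_le_sq, abs_of_nonneg (by positivity : 0 ≤ M * ‖γ q.1‖), mul_comm]
      exact (abs_real_inner_le_norm _ _).trans (by gcongr; exact hX.bound _)
    -- The cross term is kept rather than estimated, because it integrates to zero both against `e₀`
    -- (by `opt_g`) and against the product measure (since `X` is centered). Only `e₁` is replaced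
    -- by its upper bound `A`; for `e₀` no pointwise bound is available, and its marginal
    -- constraints suffice.
    have hs2 : (φ q.1 + x) ^ 2 ≤ (φ q.1 ^ 2 + M ^ 2 * ‖γ q.1‖ ^ 2) + 2 * φ q.1 * x := by
      nlinarith
    have h4 : e₀ q * (φ q.1 + x) ^ 2 + e₁ q * (φ q.1 + x) ^ 2 ≤
        e₀ q * ((φ q.1 ^ 2 + M ^ 2 * ‖γ q.1‖ ^ 2) + 2 * φ q.1 * x)
        + A * ((φ q.1 ^ 2 + M ^ 2 * ‖γ q.1‖ ^ 2) + 2 * φ q.1 * x) := by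
      gcongr
      exact upper _ (hZ q)
    have h5 := mul_le_mul_of_nonneg_left h4 (inv_pos.2 hβ).le
    rw [real_inner_smul_left, ← hx]
    have h6 : e₁ q * (β / 2 * (w - 1 - (h q.2 - k q.2) / ε) + (w + 1) * (φ q.1 + x) ^ 2 / β)
        = β / 2 * (e₀ q - e₁ q - ε⁻¹ * (e₁ q * (h q.2 - k q.2)))
        + β⁻¹ * (e₀ q * (φ q.1 + x) ^ 2 + e₁ q * (φ q.1 + x) ^ 2) := by
      rw [hwe]; field_simp
    rw [h6] at h3
    have h7 : e₁ q * ((w - 1) * (φ q.1 + x)) = e₀ q * (φ q.1 + x) - e₁ q * (φ q.1 + x) := by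
      rw [hwe]; ring
    change ε * e₁ q + e₁ q * _ + _ ≤ ε * e₂ q at h1
    linarith
  -- evaluation of the integrals
  have iφ : HasIntegral (m.prod n) (fun q => φ q.1) 0 := hf0 ▸ hasIntegral_fst hφ
  have ie₀φ : HasIntegral (m.prod n) (fun q => e₀ q * φ q.1) 0 :=
    hf0 ▸ hasIntegral_mul_fst ce₀ opt_f hφ
  have iη := hasIntegral_snd (m := m) (n := n) hη
  have ie₁η := hasIntegral_mul_snd (n := n) ce₁ opt_h hη
  have ie₀γ := hasIntegral_mul_inner (m := m) ce₀ hXc opt_g hγ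
  have ie₁h := hasIntegral_mul_snd (n := n) ce₁ opt_h (hh.sub hk)
  have ie₀ : HasIntegral (m.prod n) e₀ _ := ce₀.hasIntegral
  have ie₁ : HasIntegral (m.prod n) e₁ _ := ce₁.hasIntegral
  have ie₂ : HasIntegral (m.prod n) e₂ _ := ce₂.hasIntegral
  have csq : Continuous fun u => φ u ^ 2 + M ^ 2 * ‖γ u‖ ^ 2 := by fun_prop
  have cφγ : Continuous fun u => (2 * φ u) • γ u := by fun_prop
  have isq₀ := hasIntegral_mul_fst (m := m) ce₀ opt_f csq
  have isq := hasIntegral_fst (m := m) (n := n) csq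
  have icr₀ := hasIntegral_mul_inner (m := m) ce₀ hXc opt_g cφγ
  have icr := hasIntegral_inner (m := m) (n := n) cφγ hXc
  have iT : HasIntegral (m.prod n)
      (fun q => (φ q.1 + inner ℝ (γ q.1) (X q.2) + η q.2) ^ 2) _ :=
    Continuous.hasIntegral (by fun_prop)
  have main := (((iφ.add iη).sub (ie₂.const_mul ε)).add (ie₁.const_mul ε)).mono
    (((((iφ.sub ie₀φ).add (iη.sub ie₁η)).sub ie₀γ).add
      (((ie₀.sub ie₁).sub (ie₁h.const_mul ε⁻¹)).const_mul (β / 2))).add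
      (((isq₀.add icr₀).add ((isq.add icr).const_mul A)).const_mul β⁻¹) |>.sub
      (iT.const_mul (A⁻¹ / (2 * ε)))) key
  have hco := le_integral_sq hX hφ hγ hη hf0 hg0
  set Φ := ∫ u, φ u ^ 2 ∂m with hΦ
  set Γ := ∫ u, ‖γ u‖ ^ 2 ∂m with hΓ
  have hΦ0 : 0 ≤ Φ := integral_nonneg fun u => sq_nonneg _
  have hΓ0 : 0 ≤ Γ := integral_nonneg fun u => sq_nonneg _
  have hη0 : 0 ≤ ∫ s, η s ^ 2 ∂n := integral_nonneg fun u => sq_nonneg _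
  have hsq : ∫ u, (φ u ^ 2 + M ^ 2 * ‖γ u‖ ^ 2) ∂m = Φ + M ^ 2 * Γ := by
    rw [integral_add (Continuous.integrable_of_compactSpace (by fun_prop))
      (Continuous.integrable_of_compactSpace (by fun_prop)), integral_const_mul]
  rw [hsq, hX.mean_zero, inner_zero_right] at main
  have hfint : ∫ u, f' u ∂m = ∫ u, f u ∂m := by
    rw [integral_sub hf'.integrable_of_compactSpace hf.integrable_of_compactSpace] at hf0
    linarith
  have hηint : ∫ s, η s ∂n = ∫ s, h' s ∂n - ∫ s, k s ∂n :=
    integral_sub hh'.integrable_of_compactSpace hk.integrable_of_compactSpace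
  have hhk : ∫ s, (h - k) s ∂n = ∫ s, h s ∂n - ∫ s, k s ∂n :=
    integral_sub hh.integrable_of_compactSpace hk.integrable_of_compactSpace
  -- The entropy of `e₀` relative to `e₁` is the increment of the objective divided by `ε`.
  have hincr : β / 2 * (∫ q, e₀ q ∂(m.prod n) - ∫ q, e₁ q ∂(m.prod n)
        - ε⁻¹ * ∫ s, (h - k) s ∂n)
      = 2 * A ^ 2 * M ^ 2 / L * (dualOn ε m n X c f g k - dualOn ε m n X c f g h) := by
    rw [hhk, hβd]
    change _ = 2 * A ^ 2 * M ^ 2 / L *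
      ((∫ u, f u ∂m + ∫ s, k s ∂n - ε * (∫ q, e₁ q ∂(m.prod n) - 1))
      - (∫ u, f u ∂m + ∫ s, h s ∂n - ε * (∫ q, e₀ q ∂(m.prod n) - 1)))
    field_simp
    ring
  rw [hincr] at main
  have hlhs : dualOn ε m n X c f' g' h' - dualOn ε m n X c f g k
      = 0 + ∫ s, η s ∂n - ε * ∫ q, e₂ q ∂(m.prod n) + ε * ∫ q, e₁ q ∂(m.prod n) := by
    change (∫ u, f' u ∂m + ∫ s, h' s ∂n - ε * (∫ q, e₂ q ∂(m.prod n) - 1))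
      - (∫ u, f u ∂m + ∫ s, k s ∂n - ε * (∫ q, e₁ q ∂(m.prod n) - 1)) = _
    rw [hfint, hηint]; ring
  rw [hlhs]
  refine main.trans ?_
  -- The Young remainder is absorbed by strong convexity.
  have hrem : β⁻¹ * (Φ + M ^ 2 * Γ + 0 + A * (Φ + M ^ 2 * Γ + 0))
      ≤ A⁻¹ / (2 * ε) * ∫ q, (φ q.1 + inner ℝ (γ q.1) (X q.2) + η q.2) ^ 2 ∂(m.prod n) := by
    calc β⁻¹ * (Φ + M ^ 2 * Γ + 0 + A * (Φ + M ^ 2 * Γ + 0))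
        ≤ β⁻¹ * (2 * A * M ^ 2 * (Φ + Γ)) := by
          gcongr
          have hM2 : 1 ≤ M ^ 2 := one_le_pow₀ hM
          have h1 : Φ + M ^ 2 * Γ ≤ M ^ 2 * (Φ + Γ) := by nlinarith
          nlinarith [mul_le_mul_of_nonneg_left h1 hApos.le,
            mul_nonneg (sub_nonneg.2 hA1) (by positivity : 0 ≤ M ^ 2 * (Φ + Γ))]
      _ = A⁻¹ / (2 * ε) * (L * (Φ + Γ)) := by rw [hβd]; field_simp; ring
      _ ≤ _ := by
          gcongr
          exact (mul_le_mul_of_nonneg_left (by linarith) hLpos.le).trans hco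
  linarith

end

/-! ### Partial maximization, quadratic growth and shift invariance -/

section Ascent

variable {U S V : Type*} [TopologicalSpace U] [CompactSpace U] [SecondCountableTopology U]
  [MeasurableSpace U] [BorelSpace U] [TopologicalSpace S] [CompactSpace S]
  [SecondCountableTopology S] [MeasurableSpace S] [BorelSpace S]
  [NormedAddCommGroup V] [InnerProductSpace ℝ V] [CompleteSpace V]
  {m : Measure U} {n : Measure S} [IsProbabilityMeasure m] [IsProbabilityMeasure n]

/-- The first-order conditions in `(f, g)` characterize partial maximizers. -/
lemma dualOn_le_of_opt_fst {ε : ℝ} (hε : 0 < ε) {X : S → V} (hX : Continuous X) {c : U × S → ℝ}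
    (hc : Continuous c) {f f' : U → ℝ} {g g' : U → V} {h : S → ℝ} (hf : Continuous f)
    (hg : Continuous g) (hh : Continuous h) (hf' : Continuous f') (hg' : Continuous g')
    (opt_f : ∀ u, ∫ s, Real.exp (slack X c f g h (u, s) / ε) ∂n = 1)
    (opt_g : ∀ u, ∫ s, Real.exp (slack X c f g h (u, s) / ε) • X s ∂n = 0) :
    dualOn ε m n X c f' g' h ≤ dualOn ε m n X c f g h := by
  have ce : Continuous fun q => Real.exp (slack X c f g h q / ε) := by fun_prop
  have ce' : Continuous fun q => Real.exp (slack X c f' g' h q / ε) := by fun_prop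
  have hφ : Continuous fun u => f' u - f u := by fun_prop
  have i1 := hasIntegral_mul_fst (m := m) ce opt_f hφ
  have i2 := hasIntegral_mul_inner (m := m) ce hX opt_g (hg'.sub hg)
  have i3 := ce.hasIntegral (m := m.prod n)
  have i4 := ce'.hasIntegral (m := m.prod n)
  have main := ((i3.const_mul ε).add (i1.add i2)).mono (i4.const_mul ε) fun q => by
    have h1 := exp_tangent_div hε (slack X c f g h q) (slack X c f' g' h q)
    refine le_of_eq_of_le ?_ h1
    simp only [slack, Pi.sub_apply, inner_sub_left]; ring
  rw [integral_sub hf'.integrable_of_compactSpace hf.integrable_of_compactSpace] at main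
  unfold dualOn
  linarith

/-- The first-order condition in `h` characterizes partial maximizers. -/
lemma dualOn_le_of_opt_snd {ε : ℝ} (hε : 0 < ε) {X : S → V} (hX : Continuous X) {c : U × S → ℝ}
    (hc : Continuous c) {f : U → ℝ} {g : U → V} {h h' : S → ℝ} (hf : Continuous f)
    (hg : Continuous g) (hh : Continuous h) (hh' : Continuous h')
    (opt_h : ∀ s, ∫ u, Real.exp (slack X c f g h (u, s) / ε) ∂m = 1) :
    dualOn ε m n X c f g h' ≤ dualOn ε m n X c f g h := by
  have ce : Continuous fun q => Real.exp (slack X c f g h q / ε) := by fun_prop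
  have ce' : Continuous fun q => Real.exp (slack X c f g h' q / ε) := by fun_prop
  have hφ : Continuous fun s => h' s - h s := by fun_prop
  have i1 := hasIntegral_mul_snd (n := n) ce opt_h hφ
  have i3 := ce.hasIntegral (m := m.prod n)
  have i4 := ce'.hasIntegral (m := m.prod n)
  have main := ((i3.const_mul ε).add i1).mono (i4.const_mul ε) fun q => by
    have h1 := exp_tangent_div hε (slack X c f g h q) (slack X c f g h' q)
    refine le_of_eq_of_le ?_ h1
    simp only [slack]; ring
  rw [integral_sub hh'.integrable_of_compactSpace hh.integrable_of_compactSpace] at main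
  unfold dualOn
  linarith

/-- Quadratic growth of the suboptimality gap: it is enough to compare with the midpoint. -/
lemma sq_dist_le_dualOn_sub {ε : ℝ} (hε : 0 < ε) {X : S → V} {lam M K : ℝ}
    (hX : IsCovariate n X lam M) {c : U × S → ℝ} (hc : Continuous c)
    {f f' : U → ℝ} {g g' : U → V} {h h' : S → ℝ} (hf : Continuous f) (hg : Continuous g)
    (hh : Continuous h) (hf' : Continuous f') (hg' : Continuous g') (hh' : Continuous h')
    (hZ : ∀ q, |slack X c f g h q| ≤ K) (hZ' : ∀ q, |slack X c f' g' h' q| ≤ K)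
    (hf0 : ∫ u, (f u - f' u) ∂m = 0) (hg0 : ∫ u, (g u - g' u) ∂m = 0)
    (hmid : dualOn ε m n X c (fun u => (1 / 2 : ℝ) * (f u + f' u))
      (fun u => (1 / 2 : ℝ) • (g u + g' u)) (fun s => (1 / 2 : ℝ) * (h s + h' s))
        ≤ dualOn ε m n X c f' g' h') :
    Real.exp (-K / ε) / (4 * ε) * (min 1 lam *
      (∫ u, (f u - f' u) ^ 2 ∂m + ∫ u, ‖g u - g' u‖ ^ 2 ∂m + ∫ s, (h s - h' s) ^ 2 ∂n)) ≤
        dualOn ε m n X c f' g' h' - dualOn ε m n X c f g h := by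
  have hXc := hX.cont
  have lower : ∀ z : ℝ, |z| ≤ K → Real.exp (-K / ε) ≤ Real.exp (z / ε) := fun z hz =>
    Real.exp_le_exp.2 (by gcongr; linarith [neg_abs_le z])
  have hco := le_integral_sq hX (hf.sub hf') (hg.sub hg') (hh.sub hh') hf0 hg0
  simp only [Pi.sub_apply] at hco
  refine (mul_le_mul_of_nonneg_left hco (by positivity)).trans ?_
  have ce : Continuous fun q => Real.exp (slack X c f g h q / ε) := by fun_prop
  have ce' : Continuous fun q => Real.exp (slack X c f' g' h' q / ε) := by fun_prop
  have i1 := ce.hasIntegral (m := m.prod n)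
  have i2 := ce'.hasIntegral (m := m.prod n)
  have i3 : HasIntegral (m.prod n) (fun q => Real.exp (slack X c
      (fun u => (1 / 2 : ℝ) * (f u + f' u)) (fun u => (1 / 2 : ℝ) • (g u + g' u))
      (fun s => (1 / 2 : ℝ) * (h s + h' s)) q / ε)) _ := Continuous.hasIntegral (by fun_prop)
  have i4 : HasIntegral (m.prod n)
      (fun q => (f q.1 - f' q.1 + inner ℝ (g q.1 - g' q.1) (X q.2) + (h q.2 - h' q.2)) ^ 2) _ :=
    Continuous.hasIntegral (by fun_prop)
  have main := ((i3.const_mul ε).add (i4.const_mul (Real.exp (-K / ε) / (8 * ε)))).mono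
    (((i2.const_mul ε).add (i1.const_mul ε)).const_mul (1 / 2)) fun q => by
      have h1 := exp_midpoint_div hε (lower _ (hZ' q)) (lower _ (hZ q))
      have e1 : slack X c (fun u => (1 / 2 : ℝ) * (f u + f' u)) (fun u => (1 / 2 : ℝ) • (g u + g' u))
          (fun s => (1 / 2 : ℝ) * (h s + h' s)) q
            = (slack X c f' g' h' q + slack X c f g h q) / 2 := by
        simp only [slack, inner_add_left, real_inner_smul_left]; ring
      have e2 : f q.1 - f' q.1 + inner ℝ (g q.1 - g' q.1) (X q.2) + (h q.2 - h' q.2)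
          = slack X c f g h q - slack X c f' g' h' q := by
        simp only [slack, inner_sub_left]; ring
      rw [e1, e2]
      linarith
  unfold dualOn at hmid ⊢
  rw [integral_const_mul, integral_const_mul,
    integral_add hf.integrable_of_compactSpace hf'.integrable_of_compactSpace,
    integral_add hh.integrable_of_compactSpace hh'.integrable_of_compactSpace] at hmid
  -- The midpoint inequality sees only half of the gap, hence the factor `2`.
  have h8 : Real.exp (-K / ε) / (4 * ε) = 2 * (Real.exp (-K / ε) / (8 * ε)) := by field_simp; norm_num
  rw [h8]
  linarith

/-- The dual objective is invariant under the shifts used for normalization. -/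
lemma dualOn_shift {ε : ℝ} {X : S → V} {lam M : ℝ} (hX : IsCovariate n X lam M)
    {c : U × S → ℝ} {f : U → ℝ} {h : S → ℝ} (g : U → V) (hf : Continuous f) (hh : Continuous h)
    (a : ℝ) (b : V) :
    dualOn ε m n X c (fun u => f u - a) (fun u => g u - b) (fun s => h s + a + inner ℝ b (X s))
      = dualOn ε m n X c f g h := by
  have hXc := hX.cont
  have h1 : ∫ u, (f u - a) ∂m = ∫ u, f u ∂m - a := by
    rw [integral_sub hf.integrable_of_compactSpace (integrable_const a)]; simp
  have h2 : ∫ s, (h s + a + inner ℝ b (X s)) ∂n = ∫ s, h s ∂n + a := by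
    rw [integral_add (Continuous.integrable_of_compactSpace (by fun_prop))
      (Continuous.integrable_of_compactSpace (by fun_prop)),
      integral_add hh.integrable_of_compactSpace (integrable_const a),
      integral_inner hXc.integrable_of_compactSpace, hX.mean_zero]
    simp
  simp only [dualOn, slack_shift, h1, h2]
  ring

end Ascent

/-! ### The implicit equation for `g`: a priori bound and stability -/

section Local

variable {S V : Type*} [TopologicalSpace S] [CompactSpace S] [MeasurableSpace S] [BorelSpace S]
  [NormedAddCommGroup V] [InnerProductSpace ℝ V] [CompleteSpace V]
  {n : Measure S} [IsProbabilityMeasure n]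

lemma integral_exp_pos_of_continuous {φ : S → ℝ} (hφ : Continuous φ) :
    0 < ∫ s, Real.exp (φ s) ∂n :=
  integral_exp_pos (Continuous.integrable_of_compactSpace (by fun_prop))

lemma integral_mul_inner_eq_zero {X : S → V} (hX : Continuous X) {e : S → ℝ} (he : Continuous e)
    (h0 : ∫ s, e s • X s ∂n = 0) (v : V) :
    HasIntegral n (fun s => e s * inner ℝ v (X s)) 0 := by
  refine ⟨Continuous.integrable_of_compactSpace (by fun_prop), ?_⟩
  have hi : Integrable (fun s => e s • X s) n := Continuous.integrable_of_compactSpace (by fun_prop)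
  simp_rw [← real_inner_smul_right]
  rw [integral_inner hi, h0, inner_zero_right]

/-- A critical point of the log-partition function in the direction of `X` is a minimizer. -/
lemma integral_exp_le_of_critical {ε : ℝ} (hε : 0 < ε) {X : S → V} (hX : Continuous X)
    {h c : S → ℝ} (hh : Continuous h) (hc : Continuous c) {w : V}
    (hw : ∫ s, Real.exp ((inner ℝ w (X s) + h s - c s) / ε) • X s ∂n = 0) (v : V) :
    ∫ s, Real.exp ((inner ℝ w (X s) + h s - c s) / ε) ∂n
      ≤ ∫ s, Real.exp ((inner ℝ v (X s) + h s - c s) / ε) ∂n := by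
  have ce : Continuous fun s => Real.exp ((inner ℝ w (X s) + h s - c s) / ε) := by fun_prop
  have ce' : Continuous fun s => Real.exp ((inner ℝ v (X s) + h s - c s) / ε) := by fun_prop
  have i1 := ce.hasIntegral (m := n)
  have i2 := ce'.hasIntegral (m := n)
  have i3 := integral_mul_inner_eq_zero hX ce hw (v - w)
  have main := ((i1.const_mul ε).add i3).mono (i2.const_mul ε) fun s => by
    have h1 := exp_tangent_div hε (inner ℝ w (X s) + h s - c s) (inner ℝ v (X s) + h s - c s)
    refine le_of_eq_of_le ?_ h1
    rw [inner_sub_left]; ring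
  rw [add_zero] at main
  exact le_of_mul_le_mul_left main hε

/-- An a priori bound for critical points. -/
lemma norm_le_of_critical {ε : ℝ} (hε : 0 < ε) {X : S → V} {lam M : ℝ}
    (hX : IsCovariate n X lam M) {h c : S → ℝ} (hh : Continuous h) (hc : Continuous c) {w : V}
    (hw : ∫ s, Real.exp ((inner ℝ w (X s) + h s - c s) / ε) • X s ∂n = 0) {a b C : ℝ}
    (ha : 0 ≤ a) (hha : ∀ s, h s ≤ a) (hb : ∫ s, max (-h s) 0 ∂n ≤ b) (hc0 : ∀ s, 0 ≤ c s)
    (hcC : ∀ s, c s ≤ C) :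
    lam * ‖w‖ ≤ 2 * M * (ε * Real.exp (-1) + a + b + C) := by
  have hXc := hX.cont
  obtain ⟨s₀⟩ : Nonempty S := n.nonempty_of_neZero
  have hM0 : 0 ≤ M := (norm_nonneg _).trans (hX.bound s₀)
  have hC0 : 0 ≤ C := (hc0 s₀).trans (hcC s₀)
  have ce : Continuous fun s => Real.exp ((inner ℝ w (X s) + h s - c s) / ε) := by fun_prop
  set I := ∫ s, Real.exp ((inner ℝ w (X s) + h s - c s) / ε) ∂n with hI
  have hIpos : 0 < I := integral_exp_pos_of_continuous (by fun_prop)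
  set F := ε * Real.log I with hF
  -- The critical point minimizes the partition function, so the competitor `0` gives this bound.
  have hFle : F ≤ a := by
    have h1 : I ≤ Real.exp (a / ε) := by
      refine (integral_exp_le_of_critical hε hXc hh hc hw 0).trans ?_
      have : ∫ s, Real.exp ((inner ℝ (0 : V) (X s) + h s - c s) / ε) ∂n
          ≤ ∫ _, Real.exp (a / ε) ∂n := by
        refine integral_mono (Continuous.integrable_of_compactSpace (by fun_prop))
          (integrable_const _) fun s => ?_
        refine Real.exp_le_exp.2 (div_le_div_of_nonneg_right ?_ hε.le)
        rw [inner_zero_left]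
        linarith [hha s, hc0 s]
      simpa using this
    have h2 := (Real.log_le_iff_le_exp hIpos).2 h1
    rw [le_div_iff₀ hε] at h2
    linarith
  have iexp : HasIntegral n (fun s => Real.exp ((inner ℝ w (X s) + h s - c s) / ε)) I :=
    ce.hasIntegral
  have ineg : HasIntegral n (fun s => max (-h s) 0) _ := Continuous.hasIntegral (by fun_prop)
  have iconst : HasIntegral n (fun _ => a + C) (a + C) := ⟨integrable_const _, by simp⟩
  have ipos : HasIntegral n (fun s => max (inner ℝ w (X s)) 0) _ :=
    Continuous.hasIntegral (by fun_prop)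
  have iX : HasIntegral n (fun s => inner ℝ w (X s)) 0 :=
    ⟨Continuous.integrable_of_compactSpace (by fun_prop), by
      rw [integral_inner hXc.integrable_of_compactSpace, hX.mean_zero, inner_zero_right]⟩
  -- The inequality `x ≤ exp (x - 1)`, applied to the exponent normalized by `log I`, bounds the
  -- positive part of `⟨w, X⟩` by a multiple of a probability density plus terms controlled by `h`
  -- and `c`.
  have hpos := ipos.mono
    (((iexp.const_mul (ε * Real.exp (-1) * I⁻¹)).add ineg).add iconst) fun s => by
      have h1 := Real.add_one_le_exp ((inner ℝ w (X s) + h s - c s) / ε - Real.log I - 1)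
      have h2 : Real.exp ((inner ℝ w (X s) + h s - c s) / ε - Real.log I - 1)
          = Real.exp (-1) * I⁻¹ * Real.exp ((inner ℝ w (X s) + h s - c s) / ε) := by
        rw [sub_eq_add_neg, Real.exp_add, Real.exp_sub, Real.exp_log hIpos]
        field_simp
      rw [h2] at h1
      have h3 := mul_le_mul_of_nonneg_left h1 hε.le
      have h4 : ε * ((inner ℝ w (X s) + h s - c s) / ε - Real.log I - 1 + 1)
          = inner ℝ w (X s) + h s - c s - F := by
        rw [hF]; field_simp; ring
      rw [h4] at h3
      have h5 : 0 ≤ ε * (Real.exp (-1) * I⁻¹ * Real.exp ((inner ℝ w (X s) + h s - c s) / ε)) := by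
        positivity
      have h6 := le_max_left (-h s) 0
      have h7 := le_max_right (-h s) 0
      refine max_le ?_ ?_ <;> linarith [hcC s]
  have hpos' : ∫ s, max (inner ℝ w (X s)) 0 ∂n ≤ ε * Real.exp (-1) + a + b + C := by
    have : ε * Real.exp (-1) * I⁻¹ * I = ε * Real.exp (-1) := by field_simp
    linarith
  have isq : HasIntegral n (fun s => inner ℝ w (X s) ^ 2) _ := Continuous.hasIntegral (by fun_prop)
  -- Since `X` is centered, the `L¹` norm of `⟨w, X⟩` is twice the integral of its positive part.
  -- One factor of the square is bounded by `‖w‖ * M`.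
  have hsq := isq.mono (((ipos.const_mul 2).sub iX).const_mul (‖w‖ * M)) fun s => by
    have h1 : |inner ℝ w (X s)| ≤ ‖w‖ * M :=
      (abs_real_inner_le_norm _ _).trans (by gcongr; exact hX.bound s)
    have h2 : |inner ℝ w (X s)| = 2 * max (inner ℝ w (X s)) 0 - inner ℝ w (X s) := by
      rcases le_total 0 (inner ℝ w (X s)) with h | h
      · rw [abs_of_nonneg h, max_eq_left h]; ring
      · rw [abs_of_nonpos h, max_eq_right h]; ring
    rw [← h2, ← sq_abs, sq]
    gcongr
  have hco := (hX.coercive w).trans hsq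
  rcases (norm_nonneg w).eq_or_lt with h0 | h0
  · rw [← h0, mul_zero]
    have : 0 ≤ ∫ s, max (inner ℝ w (X s)) 0 ∂n := integral_nonneg fun s => le_max_right _ _
    have := this.trans hpos'
    positivity
  · refine le_of_mul_le_mul_left ?_ h0
    have h1 := mul_le_mul_of_nonneg_left hpos' (by positivity : 0 ≤ ‖w‖ * M * 2)
    nlinarith

/-- Critical points depend on the cost in a Lipschitz way. -/
lemma norm_sub_le_of_critical {ε : ℝ} (hε : 0 < ε) {X : S → V} {lam M : ℝ}
    (hX : IsCovariate n X lam M) {h c c' : S → ℝ} (hh : Continuous h) (hc : Continuous c)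
    (hc' : Continuous c') {w w' : V}
    (hw : ∫ s, Real.exp ((inner ℝ w (X s) + h s - c s) / ε) • X s ∂n = 0)
    (hw' : ∫ s, Real.exp ((inner ℝ w' (X s) + h s - c' s) / ε) • X s ∂n = 0) {K d : ℝ}
    (h1 : ∀ s, |inner ℝ w (X s) + h s - c s| ≤ K) (h2 : ∀ s, |inner ℝ w' (X s) + h s - c s| ≤ K)
    (h3 : ∀ s, |inner ℝ w' (X s) + h s - c' s| ≤ K) (hd : ∀ s, |c s - c' s| ≤ d) :
    ‖w - w'‖ ≤ Real.exp (K / ε) ^ 2 * M / lam * d := by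
  have hXc := hX.cont
  have hlam := hX.lam_pos
  obtain ⟨s₀⟩ : Nonempty S := n.nonempty_of_neZero
  have hM0 : 0 ≤ M := (norm_nonneg _).trans (hX.bound s₀)
  have hd0 : 0 ≤ d := (abs_nonneg _).trans (hd s₀)
  set A := Real.exp (K / ε) with hA
  have hApos : 0 < A := Real.exp_pos _
  have lower : ∀ z : ℝ, |z| ≤ K → A⁻¹ ≤ Real.exp (z / ε) := fun z hz => by
    rw [hA, ← Real.exp_neg, ← neg_div]
    exact Real.exp_le_exp.2 (by gcongr; linarith [neg_abs_le z])
  have upper : ∀ z : ℝ, |z| ≤ K → Real.exp (z / ε) ≤ A := fun z hz =>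
    Real.exp_le_exp.2 (by gcongr; linarith [le_abs_self z])
  have i1 := integral_mul_inner_eq_zero hXc (by fun_prop) hw (w - w')
  have i2 := integral_mul_inner_eq_zero hXc (by fun_prop) hw' (w - w')
  have i3 : HasIntegral n (fun _ => A / ε * d * (‖w - w'‖ * M)) (A / ε * d * (‖w - w'‖ * M)) :=
    ⟨integrable_const _, by simp⟩
  have isq : HasIntegral n (fun s => inner ℝ (w - w') (X s) ^ 2) _ :=
    Continuous.hasIntegral (by fun_prop)
  -- The two critical equations are subtracted and tested against `w - w'`. Strong monotonicity of
  -- the exponential handles the change of `w` at fixed cost `c`; the change of cost at fixed `w'`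
  -- is the Lipschitz error.
  have main := (isq.const_mul (A⁻¹ / ε)).mono ((i1.sub i2).add i3) fun s => by
    have e1 := exp_strongMonotone_div hε (lower _ (h2 s)) (lower _ (h1 s))
    have e2 : inner ℝ w (X s) + h s - c s - (inner ℝ w' (X s) + h s - c s)
        = inner ℝ (w - w') (X s) := by rw [inner_sub_left]; ring
    rw [e2] at e1
    have e3 := abs_exp_div_sub_le hε (upper _ (h2 s)) (upper _ (h3 s))
    have e4 : |inner ℝ w' (X s) + h s - c' s - (inner ℝ w' (X s) + h s - c s)| ≤ d := by
      convert hd s using 2; ring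
    have e5 : |inner ℝ (w - w') (X s)| ≤ ‖w - w'‖ * M :=
      (abs_real_inner_le_norm _ _).trans (by gcongr; exact hX.bound s)
    have e6 := e3.trans (mul_le_mul_of_nonneg_left e4 (by positivity))
    have e7 := mul_le_mul e6 e5 (abs_nonneg _) (by positivity)
    rw [← abs_mul] at e7
    have e8 := (le_abs_self _).trans e7
    linarith
  have hco := mul_le_mul_of_nonneg_left (hX.coercive (w - w')) (by positivity : 0 ≤ A⁻¹ / ε)
  have h4 : A⁻¹ / ε * (lam * ‖w - w'‖ ^ 2) ≤ A / ε * d * (‖w - w'‖ * M) := by linarith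
  rcases (norm_nonneg (w - w')).eq_or_lt with h0 | h0
  · rw [← h0]; positivity
  · refine le_of_mul_le_mul_left ?_ h0
    have h5 := mul_le_mul_of_nonneg_left h4 (by positivity : 0 ≤ A * ε / lam)
    have e1 : A * ε / lam * (A⁻¹ / ε * (lam * ‖w - w'‖ ^ 2)) = ‖w - w'‖ * ‖w - w'‖ := by
      field_simp
    have e2 : A * ε / lam * (A / ε * d * (‖w - w'‖ * M)) = ‖w - w'‖ * (A ^ 2 * M / lam * d) := by
      field_simp
    rw [e1, e2] at h5
    exact h5

end Local

/-! ### One Sinkhorn step: regularity and first-order conditions -/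

section Step

variable {U S V : Type*} [PseudoMetricSpace U] [CompactSpace U] [SecondCountableTopology U]
  [MeasurableSpace U] [BorelSpace U] [TopologicalSpace S] [CompactSpace S]
  [SecondCountableTopology S] [MeasurableSpace S] [BorelSpace S]
  [NormedAddCommGroup V] [InnerProductSpace ℝ V] [CompleteSpace V]
  {m : Measure U} {n : Measure S} [IsProbabilityMeasure m] [IsProbabilityMeasure n]

/-- A bounded nonnegative cost which is `L`-Lipschitz in the first variable. -/
structure IsLipCost (c : U × S → ℝ) (C L : ℝ) : Prop where
  cont : Continuous c
  nonneg : ∀ q, 0 ≤ c q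
  le : ∀ q, c q ≤ C
  lip : ∀ u u' s, |c (u, s) - c (u', s)| ≤ L * dist u u'

/-- One (not yet normalized) step `h ↦ (f, g, k)` of the Sinkhorn algorithm. -/
structure IsSinkhornStep (ε : ℝ) (m : Measure U) (n : Measure S) (X : S → V) (c : U × S → ℝ)
    (h : S → ℝ) (f : U → ℝ) (g : U → V) (k : S → ℝ) : Prop where
  eq_g : ∀ u, ∫ s, Real.exp ((inner ℝ (g u) (X s) + h s - c (u, s)) / ε) • X s ∂n = 0
  eq_f : ∀ u, f u = -ε * Real.log
    (∫ s, Real.exp ((inner ℝ (g u) (X s) + h s - c (u, s)) / ε) ∂n)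
  eq_h : ∀ s, k s = -ε * Real.log
    (∫ u, Real.exp ((f u + inner ℝ (g u) (X s) - c (u, s)) / ε) ∂m)

namespace IsSinkhornStep

variable {ε : ℝ} {X : S → V} {lam M C L : ℝ} {c : U × S → ℝ} {h k : S → ℝ} {f : U → ℝ} {g : U → V}

lemma norm_g_le (hε : 0 < ε) (hX : IsCovariate n X lam M) (hc : IsLipCost c C L)
    (hh : Continuous h) (H : IsSinkhornStep ε m n X c h f g k) {a b : ℝ} (ha : 0 ≤ a)
    (hha : ∀ s, h s ≤ a) (hb : ∫ s, max (-h s) 0 ∂n ≤ b) (u : U) :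
    lam * ‖g u‖ ≤ 2 * M * (ε * Real.exp (-1) + a + b + C) := by
  have := hc.cont
  exact norm_le_of_critical hε hX hh (c := fun s => c (u, s)) (by fun_prop) (H.eq_g u) ha hha hb
    (fun s => hc.nonneg _) fun s => hc.le _

/-- `g u` minimizes the partition function at `u`, so it may be replaced there by `g u'`; after that
only the cost differs. Thus `f` inherits the Lipschitz constant of the cost, independently of the
size of `g`. -/
lemma f_sub_le (hε : 0 < ε) (hX : IsCovariate n X lam M) (hc : IsLipCost c C L)
    (hh : Continuous h) (H : IsSinkhornStep ε m n X c h f g k) (u u' : U) :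
    f u' - f u ≤ L * dist u u' := by
  have hcc := hc.cont
  have hXc := hX.cont
  have hI : ∀ v, 0 < ∫ s, Real.exp ((inner ℝ (g v) (X s) + h s - c (v, s)) / ε) ∂n := fun v =>
    integral_exp_pos_of_continuous (by fun_prop)
  have h1 := integral_exp_le_of_critical hε hXc hh (c := fun s => c (u, s)) (by fun_prop)
    (H.eq_g u) (g u')
  have h2 : ∫ s, Real.exp ((inner ℝ (g u') (X s) + h s - c (u, s)) / ε) ∂n
      ≤ Real.exp (L * dist u u' / ε)
        * ∫ s, Real.exp ((inner ℝ (g u') (X s) + h s - c (u', s)) / ε) ∂n := by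
    rw [← integral_const_mul]
    refine integral_mono (Continuous.integrable_of_compactSpace (by fun_prop))
      (Continuous.integrable_of_compactSpace (by fun_prop)) fun s => ?_
    dsimp only
    rw [← Real.exp_add, ← add_div]
    refine Real.exp_le_exp.2 (div_le_div_of_nonneg_right ?_ hε.le)
    have := neg_abs_le (c (u, s) - c (u', s))
    linarith [hc.lip u u' s]
  have h3 := Real.log_le_log (hI u) (h1.trans h2)
  rw [Real.log_mul (Real.exp_pos _).ne' (hI u').ne', Real.log_exp] at h3
  have h4 := mul_le_mul_of_nonneg_left h3 hε.le
  rw [mul_add, mul_div_cancel₀ _ hε.ne'] at h4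
  rw [H.eq_f u, H.eq_f u']
  linarith

lemma continuous_f (hε : 0 < ε) (hX : IsCovariate n X lam M) (hc : IsLipCost c C L)
    (hh : Continuous h) (H : IsSinkhornStep ε m n X c h f g k) : Continuous f := by
  refine (LipschitzWith.of_dist_le' (K := L) fun u u' => ?_).continuous
  rw [Real.dist_eq, abs_le]
  have h1 := H.f_sub_le hε hX hc hh u u'
  have h2 := H.f_sub_le hε hX hc hh u' u
  rw [dist_comm] at h2
  constructor <;> linarith

/-- The a priori bound on `g` gives a uniform bound on the exponents, including those mixing `g u`
with the cost at `u'`; stability of critical points then makes `g` Lipschitz. -/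
lemma continuous_g (hε : 0 < ε) (hX : IsCovariate n X lam M) (hc : IsLipCost c C L)
    (hh : Continuous h) (H : IsSinkhornStep ε m n X c h f g k) : Continuous g := by
  have hcc := hc.cont
  have hlam := hX.lam_pos
  obtain ⟨s₀⟩ : Nonempty S := n.nonempty_of_neZero
  obtain ⟨u₀⟩ : Nonempty U := m.nonempty_of_neZero
  have hM0 : 0 ≤ M := (norm_nonneg _).trans (hX.bound s₀)
  obtain ⟨B, hB⟩ := isCompact_univ.exists_bound_of_continuousOn hh.continuousOn
  have hB : ∀ s, |h s| ≤ B := fun s => hB s (Set.mem_univ _)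
  have hB0 : 0 ≤ B := (abs_nonneg _).trans (hB s₀)
  obtain ⟨R, hR⟩ : ∃ R, ∀ u, ‖g u‖ ≤ R := ⟨_, fun u => (le_div_iff₀' hlam).2
    (H.norm_g_le hε hX hc hh hB0 (fun s => (le_abs_self _).trans (hB s)) le_rfl u)⟩
  have hR0 : 0 ≤ R := (norm_nonneg _).trans (hR u₀)
  have hK : ∀ u u' s, |inner ℝ (g u) (X s) + h s - c (u', s)| ≤ R * M + B + C := fun u u' s => by
    have h1 : |inner ℝ (g u) (X s)| ≤ R * M :=
      (abs_real_inner_le_norm _ _).trans (by gcongr; exacts [hR u, hX.bound s])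
    have h2 := hB s
    have h3 := hc.nonneg (u', s)
    have h4 := hc.le (u', s)
    rw [abs_le] at *
    constructor <;> linarith
  have hlip : ∀ u u', ‖g u - g u'‖
      ≤ Real.exp ((R * M + B + C) / ε) ^ 2 * M / lam * (L * dist u u') := fun u u' =>
    norm_sub_le_of_critical hε hX hh (c := fun s => c (u, s)) (c' := fun s => c (u', s))
      (by fun_prop) (by fun_prop) (H.eq_g u) (H.eq_g u') (hK u u) (hK u' u) (hK u' u')
      (hc.lip u u')
  refine (LipschitzWith.of_dist_le' (K := Real.exp ((R * M + B + C) / ε) ^ 2 * M / lam * L)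
    fun u u' => ?_).continuous
  rw [dist_eq_norm, mul_assoc]
  exact hlip u u'

lemma continuous_h (hε : 0 < ε) (hX : IsCovariate n X lam M) (hc : IsLipCost c C L)
    (hh : Continuous h) (H : IsSinkhornStep ε m n X c h f g k) : Continuous k := by
  have hcc := hc.cont
  have hXc := hX.cont
  have hf := H.continuous_f hε hX hc hh
  have hg := H.continuous_g hε hX hc hh
  rw [funext H.eq_h]
  refine continuous_const.mul (Continuous.log ?_ fun s =>
    (integral_exp_pos_of_continuous (by fun_prop)).ne')
  exact Continuous.integral_prod_left
    (φ := fun q : S × U => Real.exp ((f q.2 + inner ℝ (g q.2) (X q.1) - c (q.2, q.1)) / ε))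
    (by fun_prop)

lemma opt_f (hε : 0 < ε) (hX : IsCovariate n X lam M) (hc : IsLipCost c C L)
    (hh : Continuous h) (H : IsSinkhornStep ε m n X c h f g k) (u : U) :
    ∫ s, Real.exp (slack X c f g h (u, s) / ε) ∂n = 1 := by
  have hcc := hc.cont
  have hXc := hX.cont
  have hI : 0 < ∫ s, Real.exp ((inner ℝ (g u) (X s) + h s - c (u, s)) / ε) ∂n :=
    integral_exp_pos_of_continuous (by fun_prop)
  have : ∀ s, Real.exp (slack X c f g h (u, s) / ε)
      = Real.exp (f u / ε) * Real.exp ((inner ℝ (g u) (X s) + h s - c (u, s)) / ε) := fun s => by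
    rw [← Real.exp_add]; congr 1; simp only [slack]; ring
  simp_rw [this]
  rw [integral_const_mul, H.eq_f u, neg_mul, neg_div, mul_div_cancel_left₀ _ hε.ne', Real.exp_neg,
    Real.exp_log hI, inv_mul_cancel₀ hI.ne']

lemma opt_g (H : IsSinkhornStep ε m n X c h f g k) (u : U) :
    ∫ s, Real.exp (slack X c f g h (u, s) / ε) • X s ∂n = 0 := by
  have : ∀ s, Real.exp (slack X c f g h (u, s) / ε) • X s
      = Real.exp (f u / ε) • Real.exp ((inner ℝ (g u) (X s) + h s - c (u, s)) / ε) • X s :=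
    fun s => by
      rw [smul_smul, ← Real.exp_add]; congr 2; simp only [slack]; ring
  simp_rw [this]
  rw [integral_smul, H.eq_g, smul_zero]

lemma opt_h (hε : 0 < ε) (hX : IsCovariate n X lam M) (hc : IsLipCost c C L)
    (hh : Continuous h) (H : IsSinkhornStep ε m n X c h f g k) (s : S) :
    ∫ u, Real.exp (slack X c f g k (u, s) / ε) ∂m = 1 := by
  have hcc := hc.cont
  have hf := H.continuous_f hε hX hc hh
  have hg := H.continuous_g hε hX hc hh
  have hI : 0 < ∫ u, Real.exp ((f u + inner ℝ (g u) (X s) - c (u, s)) / ε) ∂m :=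
    integral_exp_pos_of_continuous (by fun_prop)
  have : ∀ u, Real.exp (slack X c f g k (u, s) / ε)
      = Real.exp (k s / ε) * Real.exp ((f u + inner ℝ (g u) (X s) - c (u, s)) / ε) := fun u => by
    rw [← Real.exp_add]; congr 1; simp only [slack]; ring
  simp_rw [this]
  rw [integral_const_mul, H.eq_h s, neg_mul, neg_div, mul_div_cancel_left₀ _ hε.ne', Real.exp_neg,
    Real.exp_log hI, inv_mul_cancel₀ hI.ne']

end IsSinkhornStep

end Step

/-- If `(f, g)` are centered and `h` is optimal given `(f, g)`, then `h` is bounded above by the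
cost. -/
lemma le_of_opt_h {U S V : Type*} [TopologicalSpace U] [CompactSpace U]
    [MeasurableSpace U] [BorelSpace U] [TopologicalSpace S] [NormedAddCommGroup V]
    [InnerProductSpace ℝ V] [CompleteSpace V] {m : Measure U} [IsProbabilityMeasure m]
    {ε : ℝ} (hε : 0 < ε) {X : S → V} {c : U × S → ℝ} {C : ℝ} (hc : Continuous c)
    (hcC : ∀ q, c q ≤ C) {f : U → ℝ} {g : U → V} {h : S → ℝ} (hf : Continuous f)
    (hg : Continuous g) (hf0 : ∫ u, f u ∂m = 0) (hg0 : ∫ u, g u ∂m = 0)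
    (opt_h : ∀ s, ∫ u, Real.exp (slack X c f g h (u, s) / ε) ∂m = 1) (s : S) : h s ≤ C := by
  have hs : Continuous fun u => slack X c f g h (u, s) := by
    simp only [slack]; fun_prop
  have i1 : HasIntegral m (fun u => Real.exp (slack X c f g h (u, s) / ε)) 1 :=
    ⟨Continuous.integrable_of_compactSpace (by fun_prop), opt_h s⟩
  have i2 : HasIntegral m f 0 := ⟨hf.integrable_of_compactSpace, hf0⟩
  have i3 : HasIntegral m (fun u => inner ℝ (X s) (g u)) 0 :=
    ⟨Continuous.integrable_of_compactSpace (by fun_prop), by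
      rw [integral_inner hg.integrable_of_compactSpace, hg0, inner_zero_right]⟩
  have i4 : HasIntegral m (fun _ => ε + h s - C) (ε + h s - C) := ⟨integrable_const _, by simp⟩
  -- Jensen in the form `1 + z ≤ exp z`, integrated over `u`: the centered `f` and `g` drop out.
  have := ((i2.add i3).add i4).mono (i1.const_mul ε) fun u => by
    have h1 := mul_le_mul_of_nonneg_left
      (Real.add_one_le_exp (slack X c f g h (u, s) / ε)) hε.le
    rw [mul_add, mul_div_cancel₀ _ hε.ne'] at h1
    refine le_trans ?_ h1
    simp only [slack, real_inner_comm (X s)]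
    linarith [hcC (u, s)]
  linarith

/-- If `h` is optimal given bounded `(f, g)`, then `h` is bounded. -/
lemma abs_le_of_opt_h {U S V : Type*} [TopologicalSpace U] [CompactSpace U]
    [MeasurableSpace U] [BorelSpace U] [TopologicalSpace S] [NormedAddCommGroup V]
    [InnerProductSpace ℝ V] {m : Measure U} [IsProbabilityMeasure m]
    {ε : ℝ} (hε : 0 < ε) {X : S → V} {c : U × S → ℝ} {C F G M : ℝ} (hc : Continuous c)
    (hc0 : ∀ q, 0 ≤ c q) (hcC : ∀ q, c q ≤ C) (hX : ∀ s, ‖X s‖ ≤ M) {f : U → ℝ} {g : U → V}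
    {h : S → ℝ} (hf : Continuous f) (hg : Continuous g) (hF : ∀ u, |f u| ≤ F)
    (hG : ∀ u, ‖g u‖ ≤ G) (opt_h : ∀ s, ∫ u, Real.exp (slack X c f g h (u, s) / ε) ∂m = 1)
    (s : S) : |h s| ≤ C + F + G * M := by
  have hs : Continuous fun u => slack X c f g h (u, s) := by
    simp only [slack]; fun_prop
  have i1 : HasIntegral m (fun u => Real.exp (slack X c f g h (u, s) / ε)) 1 :=
    ⟨Continuous.integrable_of_compactSpace (by fun_prop), opt_h s⟩
  have hb : ∀ u, |inner ℝ (g u) (X s)| ≤ G * M := fun u =>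
    (abs_real_inner_le_norm _ _).trans (mul_le_mul (hG u) (hX s) (norm_nonneg _)
      ((norm_nonneg _).trans (hG u)))
  have i2 : ∀ r : ℝ, HasIntegral m (fun _ => Real.exp (r / ε)) (Real.exp (r / ε)) := fun r =>
    ⟨integrable_const _, by simp⟩
  have h1 := (i2 (h s - (C + F + G * M))).mono i1 fun u => by
    refine Real.exp_le_exp.2 (div_le_div_of_nonneg_right ?_ hε.le)
    simp only [slack]
    linarith [hcC (u, s), neg_abs_le (f u), neg_abs_le (inner ℝ (g u) (X s)), hF u, hb u]
  have h2 := i1.mono (i2 (h s + (C + F + G * M))) fun u => by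
    refine Real.exp_le_exp.2 (div_le_div_of_nonneg_right ?_ hε.le)
    simp only [slack]
    linarith [hc0 (u, s), hcC (u, s), le_abs_self (f u), le_abs_self (inner ℝ (g u) (X s)),
      hF u, hb u]
  rw [Real.exp_le_one_iff, div_le_iff₀ hε] at h1
  rw [Real.one_le_exp_iff, le_div_iff₀ hε] at h2
  rw [abs_le]
  constructor <;> linarith

/-! ### The Sinkhorn sequence: monotonicity, uniform bounds and the one-step estimate -/

section Sequence

variable {U S V : Type*} [PseudoMetricSpace U] [CompactSpace U] [SecondCountableTopology U]
  [MeasurableSpace U] [BorelSpace U] [TopologicalSpace S] [CompactSpace S]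
  [SecondCountableTopology S] [MeasurableSpace S] [BorelSpace S]
  [NormedAddCommGroup V] [InnerProductSpace ℝ V] [CompleteSpace V]
  {m : Measure U} {n : Measure S} [IsProbabilityMeasure m] [IsProbabilityMeasure n]

/-- Continuous potentials whose first two components are centered. -/
structure IsCentered (m : Measure U) (f : U → ℝ) (g : U → V) (h : S → ℝ) : Prop where
  cont_f : Continuous f
  cont_g : Continuous g
  cont_h : Continuous h
  mean_f : ∫ u, f u ∂m = 0
  mean_g : ∫ u, g u ∂m = 0

/-- Normalized Sinkhorn iterates. -/
structure IsSinkhornSeq (ε : ℝ) (m : Measure U) (n : Measure S) (X : S → V) (c : U × S → ℝ)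
    (f : ℕ → U → ℝ) (g : ℕ → U → V) (h : ℕ → S → ℝ) (ft : ℕ → U → ℝ) (gt : ℕ → U → V)
    (ht : ℕ → S → ℝ) : Prop where
  init : IsCentered m (f 0) (g 0) (h 0)
  step : ∀ t, IsSinkhornStep ε m n X c (h t) (ft (t + 1)) (gt (t + 1)) (ht (t + 1))
  norm_f : ∀ t, f (t + 1) = fun u => ft (t + 1) u - ∫ v, ft (t + 1) v ∂m
  norm_g : ∀ t, g (t + 1) = fun u => gt (t + 1) u - ∫ v, gt (t + 1) v ∂m
  norm_h : ∀ t, h (t + 1) = fun s => ht (t + 1) s + ∫ v, ft (t + 1) v ∂m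
    + inner ℝ (∫ v, gt (t + 1) v ∂m) (X s)

lemma IsCovariate.mono {X : S → V} {lam M M' : ℝ} (hX : IsCovariate n X lam M) (hM : M ≤ M') :
    IsCovariate n X lam M' :=
  ⟨hX.cont, hX.mean_zero, hX.lam_pos, hX.coercive, fun s => (hX.bound s).trans hM⟩

namespace IsSinkhornSeq

variable {ε : ℝ} {X : S → V} {lam M C L : ℝ} {c : U × S → ℝ}
  {f : ℕ → U → ℝ} {g : ℕ → U → V} {h : ℕ → S → ℝ} {ft : ℕ → U → ℝ} {gt : ℕ → U → V}
  {ht : ℕ → S → ℝ}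

lemma isCentered (hε : 0 < ε) (hX : IsCovariate n X lam M) (hc : IsLipCost c C L)
    (H : IsSinkhornSeq ε m n X c f g h ft gt ht) (t : ℕ) : IsCentered m (f t) (g t) (h t) := by
  induction t with
  | zero => exact H.init
  | succ t ih =>
    have hXc := hX.cont
    have hf := (H.step t).continuous_f hε hX hc ih.cont_h
    have hg := (H.step t).continuous_g hε hX hc ih.cont_h
    have hh := (H.step t).continuous_h hε hX hc ih.cont_h
    refine ⟨?_, ?_, ?_, ?_, ?_⟩
    · rw [H.norm_f]; fun_prop
    · rw [H.norm_g]; fun_prop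
    · rw [H.norm_h]; fun_prop
    · rw [H.norm_f, integral_sub hf.integrable_of_compactSpace (integrable_const _)]; simp
    · rw [H.norm_g, integral_sub hg.integrable_of_compactSpace (integrable_const _)]; simp

lemma opt_h (hε : 0 < ε) (hX : IsCovariate n X lam M) (hc : IsLipCost c C L)
    (H : IsSinkhornSeq ε m n X c f g h ft gt ht) (t : ℕ) (s : S) :
    ∫ u, Real.exp (slack X c (f (t + 1)) (g (t + 1)) (h (t + 1)) (u, s) / ε) ∂m = 1 := by
  rw [H.norm_f, H.norm_g, H.norm_h, slack_shift]
  exact (H.step t).opt_h hε hX hc (H.isCentered hε hX hc t).cont_h s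

/-- After the `h` update the Gibbs density has total mass one, and `f` is centered. Monotonicity of
the objective thereby becomes a lower bound on `∫ h`. -/
lemma dualOn_succ_eq (hε : 0 < ε) (hX : IsCovariate n X lam M) (hc : IsLipCost c C L)
    (H : IsSinkhornSeq ε m n X c f g h ft gt ht) (t : ℕ) :
    dualOn ε m n X c (f (t + 1)) (g (t + 1)) (h (t + 1)) = ∫ s, h (t + 1) s ∂n := by
  have hXc := hX.cont
  have hcc := hc.cont
  have hC := H.isCentered hε hX hc (t + 1)
  have hf := hC.cont_f
  have hg := hC.cont_g
  have hh := hC.cont_h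
  have h1 := (hasIntegral_mul_snd (m := m) (n := n) (e := fun q =>
    Real.exp (slack X c (f (t + 1)) (g (t + 1)) (h (t + 1)) q / ε)) (by fun_prop)
    (H.opt_h hε hX hc t) (φ := fun _ => 1) continuous_const).2
  simp only [mul_one, integral_const, probReal_univ, smul_eq_mul] at h1
  rw [dualOn, h1, hC.mean_f]
  ring

lemma dualOn_le_partial (hε : 0 < ε) (hX : IsCovariate n X lam M) (hc : IsLipCost c C L)
    (H : IsSinkhornSeq ε m n X c f g h ft gt ht) (t : ℕ) :
    dualOn ε m n X c (f t) (g t) (h t)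
      ≤ dualOn ε m n X c (ft (t + 1)) (gt (t + 1)) (h t) := by
  have hC := H.isCentered hε hX hc t
  exact dualOn_le_of_opt_fst hε hX.cont hc.cont
    ((H.step t).continuous_f hε hX hc hC.cont_h) ((H.step t).continuous_g hε hX hc hC.cont_h)
    hC.cont_h hC.cont_f hC.cont_g ((H.step t).opt_f hε hX hc hC.cont_h) (H.step t).opt_g

lemma dualOn_succ_shift (hε : 0 < ε) (hX : IsCovariate n X lam M) (hc : IsLipCost c C L)
    (H : IsSinkhornSeq ε m n X c f g h ft gt ht) (t : ℕ) :
    dualOn ε m n X c (f (t + 1)) (g (t + 1)) (h (t + 1))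
      = dualOn ε m n X c (ft (t + 1)) (gt (t + 1)) (ht (t + 1)) := by
  have hC := H.isCentered hε hX hc t
  rw [H.norm_f, H.norm_g, H.norm_h]
  exact dualOn_shift hX _ ((H.step t).continuous_f hε hX hc hC.cont_h)
    ((H.step t).continuous_h hε hX hc hC.cont_h) _ _

lemma dualOn_le_succ (hε : 0 < ε) (hX : IsCovariate n X lam M) (hc : IsLipCost c C L)
    (H : IsSinkhornSeq ε m n X c f g h ft gt ht) (t : ℕ) :
    dualOn ε m n X c (f t) (g t) (h t)
      ≤ dualOn ε m n X c (f (t + 1)) (g (t + 1)) (h (t + 1)) := by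
  have hC := H.isCentered hε hX hc t
  rw [H.dualOn_succ_shift hε hX hc]
  exact (H.dualOn_le_partial hε hX hc t).trans (dualOn_le_of_opt_snd hε hX.cont hc.cont
    ((H.step t).continuous_f hε hX hc hC.cont_h) ((H.step t).continuous_g hε hX hc hC.cont_h)
    ((H.step t).continuous_h hε hX hc hC.cont_h) hC.cont_h
    ((H.step t).opt_h hε hX hc hC.cont_h))

lemma dualOn_zero_le (hε : 0 < ε) (hX : IsCovariate n X lam M) (hc : IsLipCost c C L)
    (H : IsSinkhornSeq ε m n X c f g h ft gt ht) (t : ℕ) :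
    dualOn ε m n X c (f 0) (g 0) (h 0) ≤ dualOn ε m n X c (f t) (g t) (h t) :=
  monotone_nat_of_le_succ (H.dualOn_le_succ hε hX hc) (Nat.zero_le t)

lemma h_succ_le (hε : 0 < ε) (hX : IsCovariate n X lam M) (hc : IsLipCost c C L)
    (H : IsSinkhornSeq ε m n X c f g h ft gt ht) (t : ℕ) (s : S) : h (t + 1) s ≤ C := by
  have hC := H.isCentered hε hX hc (t + 1)
  exact le_of_opt_h hε hc.cont hc.le hC.cont_f hC.cont_g hC.mean_f hC.mean_g
    (H.opt_h hε hX hc t) s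

lemma dualOn_zero_le_cost (hε : 0 < ε) (hX : IsCovariate n X lam M) (hc : IsLipCost c C L)
    (H : IsSinkhornSeq ε m n X c f g h ft gt ht) :
    dualOn ε m n X c (f 0) (g 0) (h 0) ≤ C := by
  refine (H.dualOn_zero_le hε hX hc 1).trans ?_
  rw [H.dualOn_succ_eq hε hX hc 0]
  have hi := (H.isCentered hε hX hc 1).cont_h.integrable_of_compactSpace (m := n)
  refine (integral_mono hi (integrable_const C) (H.h_succ_le hε hX hc 0)).trans ?_
  simp

/-- A centered function is the average of its own differences, so it is bounded by its oscillation.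
-/
lemma abs_f_succ_le (hε : 0 < ε) (hX : IsCovariate n X lam M) (hc : IsLipCost c C L)
    (H : IsSinkhornSeq ε m n X c f g h ft gt ht) {Δ : ℝ} (hΔ : ∀ u u' : U, L * dist u u' ≤ Δ)
    (t : ℕ) (u : U) : |f (t + 1) u| ≤ Δ := by
  have hC := H.isCentered hε hX hc t
  have hf := ((H.step t).continuous_f hε hX hc hC.cont_h)
  have i1 : HasIntegral m (fun v => ft (t + 1) u - ft (t + 1) v) (f (t + 1) u) :=
    ⟨Continuous.integrable_of_compactSpace (by fun_prop), by
      rw [integral_sub (integrable_const _) hf.integrable_of_compactSpace, H.norm_f]; simp⟩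
  have i2 : ∀ r : ℝ, HasIntegral m (fun _ => r) r := fun r => ⟨integrable_const _, by simp⟩
  rw [abs_le]
  constructor
  · refine (i2 _).mono i1 fun v => ?_
    linarith [(H.step t).f_sub_le hε hX hc hC.cont_h u v, hΔ u v]
  · refine i1.mono (i2 _) fun v => ?_
    linarith [(H.step t).f_sub_le hε hX hc hC.cont_h v u, hΔ v u]

/-- Uniform bound on the vector-valued iterates in terms of the initial data. -/
lemma norm_g_succ_le (hε : 0 < ε) (hX : IsCovariate n X lam M) (hc : IsLipCost c C L)
    (H : IsSinkhornSeq ε m n X c f g h ft gt ht) {H₀ B : ℝ} (hH₀ : ∀ s, |h 0 s| ≤ H₀)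
    (hB₀ : ε * Real.exp (-1) + H₀ + H₀ + C ≤ B)
    (hB₁ : ε * Real.exp (-1) + C + (C - dualOn ε m n X c (f 0) (g 0) (h 0)) + C ≤ B)
    (t : ℕ) (u : U) : lam * ‖g (t + 1) u‖ ≤ 4 * M * B := by
  obtain ⟨s₀⟩ : Nonempty S := n.nonempty_of_neZero
  have hM0 : 0 ≤ M := (norm_nonneg _).trans (hX.bound s₀)
  have hC0 : 0 ≤ C := (hc.nonneg (u, s₀)).trans (hc.le _)
  have hC := H.isCentered hε hX hc t
  have hh := hC.cont_h
  have hg := ((H.step t).continuous_g hε hX hc hC.cont_h)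
  have i2 : ∀ r : ℝ, HasIntegral n (fun _ : S => r) r := fun r => ⟨integrable_const _, by simp⟩
  have i1 : HasIntegral n (fun s => max (-h t s) 0) _ := Continuous.hasIntegral (by fun_prop)
  have key : ∀ v, lam * ‖gt (t + 1) v‖ ≤ 2 * M * B := by
    intro v
    -- The first step only has the bound on `h 0`. Later steps use `h ≤ C` and `D₀ ≤ ∫ h`, which
    -- give `∫ max (-h) 0 ≤ ∫ (C - h) ≤ C - D₀`.
    rcases t with _ | t
    · refine ((H.step 0).norm_g_le hε hX hc hh ((abs_nonneg _).trans (hH₀ s₀))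
        (fun s => (le_abs_self _).trans (hH₀ s)) (b := H₀) ?_ v).trans (by gcongr)
      exact i1.mono (i2 _) fun s =>
        max_le ((neg_le_abs _).trans (hH₀ s)) ((abs_nonneg _).trans (hH₀ s))
    · refine ((H.step (t + 1)).norm_g_le hε hX hc hh hC0 (H.h_succ_le hε hX hc t)
        (b := C - dualOn ε m n X c (f 0) (g 0) (h 0)) ?_ v).trans (by gcongr)
      have h1 := i1.mono ((i2 C).sub (hh.hasIntegral (m := n))) fun s => by
        have := H.h_succ_le hε hX hc t s
        exact max_le (by linarith) (by linarith)
      have h2 := H.dualOn_zero_le hε hX hc (t + 1)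
      rw [H.dualOn_succ_eq hε hX hc t] at h2
      linarith
  have hlam := hX.lam_pos
  have key' : ∀ v, ‖gt (t + 1) v‖ ≤ 2 * M * B / lam := fun v => (le_div_iff₀' hlam).2 (key v)
  have h1 : ‖∫ v, gt (t + 1) v ∂m‖ ≤ 2 * M * B / lam := by
    simpa using norm_integral_le_of_norm_le_const (Eventually.of_forall key') (μ := m)
  rw [H.norm_g]
  -- Centering at most doubles the bound, which turns `2 * M * B` into `4 * M * B`.
  have h2 := mul_le_mul_of_nonneg_left
    ((norm_sub_le (gt (t + 1) u) (∫ v, gt (t + 1) v ∂m)).trans (add_le_add (key' u) h1)) hlam.le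
  refine h2.trans (le_of_eq ?_)
  field_simp
  ring

/-- The gap after a step is controlled by the increment of the dual objective in that step. -/
lemma dualOn_sub_succ_le (hε : 0 < ε) (hX : IsCovariate n X lam M) (hM : 1 ≤ M)
    (hc : IsLipCost c C L) (H : IsSinkhornSeq ε m n X c f g h ft gt ht) {K : ℝ} (hK : 0 ≤ K)
    {fb : U → ℝ} {gb : U → V} {hb : S → ℝ} (hb' : IsCentered m fb gb hb)
    (hZb : ∀ q, |slack X c fb gb hb q| ≤ K) (t : ℕ)
    (hZ : ∀ q, |slack X c (f (t + 1)) (g (t + 1)) (h (t + 1)) q| ≤ K) :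
    dualOn ε m n X c fb gb hb - dualOn ε m n X c (f (t + 1)) (g (t + 1)) (h (t + 1)) ≤
      2 * Real.exp (K / ε) ^ 2 * M ^ 2 / min 1 lam *
        (dualOn ε m n X c (f (t + 1)) (g (t + 1)) (h (t + 1))
          - dualOn ε m n X c (f t) (g t) (h t)) := by
  have hXc := hX.cont
  have hlam := hX.lam_pos
  have hC := H.isCentered hε hX hc t
  have hC' := H.isCentered hε hX hc (t + 1)
  have hh := hC.cont_h
  have hft := (H.step t).continuous_f hε hX hc hh
  -- The normalizing shift of step `t + 1` is applied to `h t` as well, so that the states before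
  -- and after the `h` update share the same centered `(f, g)`.
  have hslack : slack X c (f (t + 1)) (g (t + 1)) (fun s => h t s + ∫ v, ft (t + 1) v ∂m
      + inner ℝ (∫ v, gt (t + 1) v ∂m) (X s)) = slack X c (ft (t + 1)) (gt (t + 1)) (h t) := by
    rw [H.norm_f, H.norm_g, slack_shift]
  have hdual : dualOn ε m n X c (f (t + 1)) (g (t + 1)) (fun s => h t s + ∫ v, ft (t + 1) v ∂m
      + inner ℝ (∫ v, gt (t + 1) v ∂m) (X s))
      = dualOn ε m n X c (ft (t + 1)) (gt (t + 1)) (h t) := by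
    rw [H.norm_f, H.norm_g, dualOn_shift hX _ hft hh]
  have main := dualOn_sub_le_increment (m := m) hε hX hM hc.cont hC'.cont_f hC'.cont_g
    (h := fun s => h t s + ∫ v, ft (t + 1) v ∂m + inner ℝ (∫ v, gt (t + 1) v ∂m) (X s))
    (by fun_prop) hC'.cont_h hb'.cont_f hb'.cont_g hb'.cont_h
    (by rw [hslack]; exact (H.step t).opt_f hε hX hc hh)
    (by rw [hslack]; exact (H.step t).opt_g) (H.opt_h hε hX hc t) hK hZ hZb
    (by rw [integral_sub hb'.cont_f.integrable_of_compactSpace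
          hC'.cont_f.integrable_of_compactSpace, hb'.mean_f, hC'.mean_f, sub_zero])
    (by rw [integral_sub hb'.cont_g.integrable_of_compactSpace
          hC'.cont_g.integrable_of_compactSpace, hb'.mean_g, hC'.mean_g, sub_zero])
  refine main.trans ?_
  rw [hdual]
  have : 0 < min 1 lam := lt_min one_pos hlam
  gcongr
  -- The `(f, g)` update does not decrease the objective, so the increment of the `h` update is at
  -- most that of the full step.
  exact H.dualOn_le_partial hε hX hc t

end IsSinkhornSeq

end Sequence

/-- A gap that is dominated by a multiple of its decrements decays geometrically. -/
lemma le_inv_pow_mul_of_le_mul_sub {a : ℕ → ℝ} {Q τ : ℝ} (ha : ∀ t, 0 ≤ a t) (hτ : 0 ≤ τ)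
    (hQ : 0 < Q) (hQτ : τ * Q ≤ 1) (h : ∀ t, a (t + 1) ≤ Q * (a t - a (t + 1))) (t : ℕ) :
    a t ≤ ((1 + τ) ^ t)⁻¹ * a 0 := by
  induction t with
  | zero => simp
  | succ t ih =>
    have h1 : 0 ≤ a t - a (t + 1) := nonneg_of_mul_nonneg_right ((ha _).trans (h t)) hQ
    have h2 : τ * a (t + 1) ≤ a t - a (t + 1) := by
      nlinarith [mul_le_mul_of_nonneg_left (h t) hτ, mul_le_mul_of_nonneg_right hQτ h1]
    have h3 : a (t + 1) ≤ (1 + τ)⁻¹ * a t := by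
      rw [le_inv_mul_iff₀ (by positivity)]; linarith
    refine h3.trans ((mul_le_mul_of_nonneg_left ih (by positivity)).trans (le_of_eq ?_))
    rw [pow_succ, mul_inv]; ring

/-! ### The smallest eigenvalue of a symmetric matrix -/

section SmallestEigenvalue

variable {d : ℕ} {A : Matrix (Fin d) (Fin d) ℝ}

/-- Subtracting a scalar matrix shifts the spectrum, so `A` minus its smallest eigenvalue is
positive semidefinite. -/
lemma sInf_spectrum_mul_le (hA : A.IsHermitian) (v : E d) :
    sInf (spectrum ℝ A) * ‖v‖ ^ 2 ≤ v.ofLp ⬝ᵥ A.mulVec v.ofLp := by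
  have hbdd : BddBelow (spectrum ℝ A) := A.finite_real_spectrum.bddBelow
  have hps : (A - algebraMap ℝ (Matrix (Fin d) (Fin d) ℝ) (sInf (spectrum ℝ A))).PosSemidef := by
    rw [Matrix.posSemidef_iff_isHermitian_and_spectrum_nonneg]
    refine ⟨hA.sub ?_, ?_⟩
    · rw [Matrix.algebraMap_eq_diagonal]
      exact Matrix.isHermitian_diagonal _
    · rw [← spectrum.sub_singleton_eq]
      rintro _ ⟨a, ha, b, rfl, rfl⟩
      exact sub_nonneg.2 (csInf_le hbdd ha)
  have h := hps.dotProduct_mulVec_nonneg v.ofLp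
  rw [Matrix.sub_mulVec, dotProduct_sub, Algebra.algebraMap_eq_smul_one, Matrix.smul_mulVec,
    Matrix.one_mulVec, dotProduct_smul, star_trivial] at h
  have h2 : v.ofLp ⬝ᵥ v.ofLp = ‖v‖ ^ 2 := by
    rw [EuclideanSpace.real_norm_sq_eq]
    simp [dotProduct, sq]
  rw [h2, smul_eq_mul] at h
  linarith

lemma exists_unit_eigenvector (hd : 0 < d) (hA : A.IsHermitian) :
    ∃ v : E d, ‖v‖ = 1 ∧ A.mulVec v.ofLp = sInf (spectrum ℝ A) • v.ofLp := by
  have hne : (spectrum ℝ A).Nonempty := ⟨_, hA.eigenvalues_mem_spectrum_real ⟨0, hd⟩⟩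
  have hmem := hne.csInf_mem A.finite_real_spectrum
  rw [hA.spectrum_real_eq_range_eigenvalues] at hmem ⊢
  obtain ⟨i, hi⟩ := hmem
  exact ⟨hA.eigenvectorBasis i, hA.eigenvectorBasis.orthonormal.1 i, by
    rw [← hi]; exact hA.mulVec_eigenvectorBasis i⟩

/-- The hypothesis `hd` matters: in dimension zero the spectrum is empty and `sInf ∅ = 0`. -/
lemma sInf_spectrum_pos (hd : 0 < d) (hA : A.PosDef) : 0 < sInf (spectrum ℝ A) := by
  have hne : (spectrum ℝ A).Nonempty := ⟨_, hA.1.eigenvalues_mem_spectrum_real ⟨0, hd⟩⟩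
  have hmem := hne.csInf_mem A.finite_real_spectrum
  rw [hA.1.spectrum_real_eq_range_eigenvalues] at hmem ⊢
  obtain ⟨i, hi⟩ := hmem
  rw [← hi]
  exact hA.eigenvalues_pos i

/-- The inverse is tested on a unit eigenvector for the smallest eigenvalue. This links the
coercivity constant to the operator norm in `boundG`. -/
lemma inv_sInf_spectrum_le_norm (hd : 0 < d) (hA : A.PosDef) :
    (sInf (spectrum ℝ A))⁻¹ ≤ ‖Matrix.toEuclideanCLM (𝕜 := ℝ) A⁻¹‖ := by
  have hpos := sInf_spectrum_pos hd hA
  obtain ⟨v, hv, hAv⟩ := exists_unit_eigenvector hd hA.1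
  set l := sInf (spectrum ℝ A)
  have hdet : IsUnit A.det := (Matrix.isUnit_iff_isUnit_det A).1 hA.isUnit
  have h1 : Matrix.toEuclideanCLM (𝕜 := ℝ) A⁻¹ v = l⁻¹ • v := by
    ext1
    rw [Matrix.ofLp_toEuclideanCLM]
    have h2 : A⁻¹.mulVec (A.mulVec v.ofLp) = v.ofLp := by
      rw [Matrix.mulVec_mulVec, Matrix.nonsing_inv_mul _ hdet, Matrix.one_mulVec]
    rw [hAv, Matrix.mulVec_smul] at h2
    rw [WithLp.ofLp_smul, ← h2, smul_smul, inv_mul_cancel₀ hpos.ne', one_smul, h2]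
  have h3 := (Matrix.toEuclideanCLM (𝕜 := ℝ) A⁻¹).le_opNorm v
  rwa [h1, norm_smul, hv, mul_one, mul_one, Real.norm_of_nonneg (inv_pos.2 hpos).le] at h3

end SmallestEigenvalue

lemma dotProduct_mulVec_secondMoment {S : Type*} [TopologicalSpace S] [CompactSpace S]
    [MeasurableSpace S] [BorelSpace S] {n : Measure S} [IsFiniteMeasure n] {d : ℕ} {X : S → E d}
    (hX : Continuous X) (v : E d) :
    v.ofLp ⬝ᵥ (Matrix.of fun i j => ∫ s, X s i * X s j ∂n).mulVec v.ofLp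
      = ∫ s, inner ℝ v (X s) ^ 2 ∂n := by
  have h1 : ∀ s, inner ℝ v (X s) ^ 2 = ∑ i, ∑ j, v i * v j * (X s i * X s j) := fun s => by
    rw [PiLp.inner_apply, sq, Finset.sum_mul_sum]
    refine Finset.sum_congr rfl fun i _ => Finset.sum_congr rfl fun j _ => ?_
    simp; ring
  have hi : ∀ i j, Integrable (fun s => v i * v j * (X s i * X s j)) n := fun i j =>
    Continuous.integrable_of_compactSpace (by fun_prop)
  simp_rw [h1]
  rw [integral_finsetSum _ fun i _ => integrable_finsetSum _ fun j _ => hi i j]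
  simp only [dotProduct, Matrix.mulVec, Matrix.of_apply, Finset.mul_sum]
  refine Finset.sum_congr rfl fun i _ => ?_
  rw [integral_finsetSum _ fun j _ => hi i j]
  refine Finset.sum_congr rfl fun j _ => ?_
  rw [integral_const_mul]; ring

/-! ### Transfer between the ambient spaces and the supports -/

section Transfer

/-- The restriction of a measure to a subtype. -/
abbrev onSubtype {α : Type*} [MeasurableSpace α] (μ : Measure α) (s : Set α) : Measure s :=
  μ.comap Subtype.val

section General

variable {α : Type*} [MeasurableSpace α] {μ : Measure α} {s : Set α}

lemma map_onSubtype (hs : MeasurableSet s) (hμ : s ∈ ae μ) :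
    (onSubtype μ s).map Subtype.val = μ := by
  rw [map_comap_subtype_coe hs, Measure.restrict_eq_self_of_ae_mem hμ]

lemma isProbabilityMeasure_onSubtype [IsProbabilityMeasure μ] (hs : MeasurableSet s)
    (hμ : s ∈ ae μ) : IsProbabilityMeasure (onSubtype μ s) := by
  refine isProbabilityMeasure_comap Subtype.val_injective ?_ fun t ht => hs.subtype_image ht
  rw [Subtype.range_coe]
  exact hμ

/-- The inclusion is a measurable embedding, so nothing is asked of `φ`; the potentials are
arbitrary off the supports and may fail to be measurable there. -/
lemma integral_onSubtype {F : Type*} [NormedAddCommGroup F] [NormedSpace ℝ F]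
    (hs : MeasurableSet s) (hμ : s ∈ ae μ) (φ : α → F) :
    ∫ a, φ a ∂(onSubtype μ s) = ∫ a, φ a ∂μ := by
  rw [← (MeasurableEmbedding.subtype_coe hs).integral_map, map_onSubtype hs hμ]

lemma integrable_onSubtype_iff {F : Type*} [NormedAddCommGroup F]
    (hs : MeasurableSet s) (hμ : s ∈ ae μ) {φ : α → F} :
    Integrable (fun a : s => φ a) (onSubtype μ s) ↔ Integrable φ μ := by
  conv_rhs => rw [← map_onSubtype hs hμ]
  exact (MeasurableEmbedding.subtype_coe hs).integrable_map_iff.symm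

variable {β : Type*} [MeasurableSpace β] {ν : Measure β} {t : Set β}
  [IsProbabilityMeasure μ] [IsProbabilityMeasure ν]

lemma map_prod_onSubtype (hs : MeasurableSet s) (hμ : s ∈ ae μ) (ht : MeasurableSet t)
    (hν : t ∈ ae ν) :
    ((onSubtype μ s).prod (onSubtype ν t)).map (Prod.map Subtype.val Subtype.val) = μ.prod ν := by
  have := isProbabilityMeasure_onSubtype hs hμ
  have := isProbabilityMeasure_onSubtype ht hν
  rw [← Measure.map_prod_map _ _ measurable_subtype_coe measurable_subtype_coe,
    map_onSubtype hs hμ, map_onSubtype ht hν]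

lemma integral_prod_onSubtype {F : Type*} [NormedAddCommGroup F] [NormedSpace ℝ F]
    (hs : MeasurableSet s) (hμ : s ∈ ae μ) (ht : MeasurableSet t) (hν : t ∈ ae ν)
    (φ : α × β → F) :
    ∫ q, φ (q.1, q.2) ∂((onSubtype μ s).prod (onSubtype ν t)) = ∫ q, φ q ∂(μ.prod ν) := by
  rw [← map_prod_onSubtype hs hμ ht hν, ((MeasurableEmbedding.subtype_coe hs).prodMap
    (MeasurableEmbedding.subtype_coe ht)).integral_map]
  rfl

lemma integrable_prod_onSubtype_iff {F : Type*} [NormedAddCommGroup F]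
    (hs : MeasurableSet s) (hμ : s ∈ ae μ) (ht : MeasurableSet t) (hν : t ∈ ae ν)
    {φ : α × β → F} :
    Integrable (fun q : s × t => φ (q.1, q.2)) ((onSubtype μ s).prod (onSubtype ν t)) ↔
      Integrable φ (μ.prod ν) := by
  conv_rhs => rw [← map_prod_onSubtype hs hμ ht hν, ((MeasurableEmbedding.subtype_coe hs).prodMap
    (MeasurableEmbedding.subtype_coe ht)).integrable_map_iff]
  rfl

end General

lemma norm_le_supNorm {α F : Type*} [TopologicalSpace α] [SeminormedAddCommGroup F] {s : Set α}
    (hs : IsCompact s) {φ : α → F} (hφ : ContinuousOn φ s) {a : α} (ha : a ∈ s) :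
    ‖φ a‖ ≤ supNorm s φ := by
  obtain ⟨C, hC⟩ := hs.exists_bound_of_continuousOn hφ
  exact le_ciSup (f := fun a : s => ‖φ a‖) ⟨C, by rintro _ ⟨b, rfl⟩; exact hC b b.2⟩ ⟨a, ha⟩

variable {dx dy : ℕ} {μ : Measure (E dy)} {ν : Measure (E dx × E dy)}
  [IsProbabilityMeasure μ] [IsProbabilityMeasure ν]

/-- The product of the supports of the two marginals. -/
abbrev suppXY (ν : Measure (E dx × E dy)) : Set (E dx × E dy) := suppX ν ×ˢ suppY ν

/-- The product of the marginal supports may exceed the support of `ν`, but it is compact, carries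
full mass, and is where the `h` update is prescribed. -/
lemma suppXY_mem_ae : suppXY ν ∈ ae ν := by
  have h1 : Prod.fst ⁻¹' suppX ν ∈ ae ν :=
    Measure.tendsto_ae_map measurable_fst.aemeasurable Measure.support_mem_ae
  have h2 : Prod.snd ⁻¹' suppY ν ∈ ae ν :=
    Measure.tendsto_ae_map measurable_snd.aemeasurable Measure.support_mem_ae
  exact inter_mem h1 h2

lemma measurableSet_suppXY : MeasurableSet (suppXY ν) :=
  (Measure.isClosed_support.prod Measure.isClosed_support).measurableSet

lemma measurableSet_support : MeasurableSet μ.support := Measure.isClosed_support.measurableSet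

/-- The covariate and the cost on the supports. -/
def covariateOn (ν : Measure (E dx × E dy)) (s : suppXY ν) : E dx := s.1.1

/-- The ground cost on the supports. -/
def costOn (μ : Measure (E dy)) (ν : Measure (E dx × E dy)) (q : μ.support × suppXY ν) : ℝ :=
  cost q.1.1 q.2.1.2

lemma dualObj_eq_dualOn (ε : ℝ) (f : E dy → ℝ) (g : E dy → E dx) (h : E dx × E dy → ℝ) :
    dualObj ε μ ν f g h = dualOn ε (onSubtype μ μ.support) (onSubtype ν (suppXY ν))
      (covariateOn ν) (costOn μ ν) (fun u => f u) (fun u => g u) (fun s => h s) := by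
  rw [dualObj, dualOn, integral_onSubtype measurableSet_support Measure.support_mem_ae,
    integral_onSubtype measurableSet_suppXY suppXY_mem_ae, iota,
    ← integral_prod_onSubtype measurableSet_support Measure.support_mem_ae measurableSet_suppXY
      suppXY_mem_ae]
  rfl

lemma isCentered_iff_isNormalized (f : E dy → ℝ) (g : E dy → E dx) (h : E dx × E dy → ℝ) :
    IsCentered (onSubtype μ μ.support) (fun u => f u) (fun u => g u) (fun s : suppXY ν => h s) ↔
      IsNormalized μ ν f g h := by
  constructor
  · rintro ⟨h1, h2, h3, h4, h5⟩
    rw [integral_onSubtype measurableSet_support Measure.support_mem_ae] at h4 h5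
    exact ⟨continuousOn_iff_continuous_domRestrict.2 h1, continuousOn_iff_continuous_domRestrict.2 h2,
      continuousOn_iff_continuous_domRestrict.2 h3, h4, h5⟩
  · rintro ⟨h1, h2, h3, h4, h5⟩
    rw [← integral_onSubtype measurableSet_support Measure.support_mem_ae] at h4 h5
    exact ⟨continuousOn_iff_continuous_domRestrict.1 h1, continuousOn_iff_continuous_domRestrict.1 h2,
      continuousOn_iff_continuous_domRestrict.1 h3, h4, h5⟩

namespace StandingAssumption

lemma compact_suppXY (hA : StandingAssumption μ ν) : IsCompact (suppXY ν) := hA.compact_X.prod hA.compact_Y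

lemma covX_eq : covX ν = Matrix.of fun i j =>
    ∫ s, covariateOn ν s i * covariateOn ν s j ∂(onSubtype ν (suppXY ν)) := by
  ext i j
  rw [covX, Matrix.of_apply, Matrix.of_apply,
    ← integral_onSubtype measurableSet_suppXY suppXY_mem_ae]
  rfl

lemma dotProduct_covX (hA : StandingAssumption μ ν) (v : E dx) : v.ofLp ⬝ᵥ (covX ν).mulVec v.ofLp
    = ∫ s, inner ℝ v (covariateOn ν s) ^ 2 ∂(onSubtype ν (suppXY ν)) := by
  have := isCompact_iff_compactSpace.1 hA.compact_suppXY
  have := isProbabilityMeasure_onSubtype (measurableSet_suppXY (ν := ν)) suppXY_mem_ae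
  have hX : Continuous (covariateOn ν) := by unfold covariateOn; fun_prop
  rw [covX_eq, dotProduct_mulVec_secondMoment hX]

lemma posDef_covX (hA : StandingAssumption μ ν) : (covX ν).PosDef := by
  have hps : (covX ν).PosSemidef := by
    refine .of_dotProduct_mulVec_nonneg ?_ fun v => ?_
    · ext i j
      simp [covX, mul_comm]
    · have := hA.dotProduct_covX (WithLp.toLp 2 v)
      rw [star_trivial]
      simp only at this
      rw [this]
      exact integral_nonneg fun s => sq_nonneg _
  exact hps.posDef_iff_isUnit.2 hA.cov_invertible

lemma lamMin_pos (hA : StandingAssumption μ ν) (hdx : 0 < dx) : 0 < lamMin ν := sInf_spectrum_pos hdx hA.posDef_covX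

lemma inv_lamMin_le (hA : StandingAssumption μ ν) (hdx : 0 < dx) : (lamMin ν)⁻¹ ≤ covInvNorm ν :=
  inv_sInf_spectrum_le_norm hdx hA.posDef_covX

lemma isCovariate (hA : StandingAssumption μ ν) (hdx : 0 < dx) :
    IsCovariate (onSubtype ν (suppXY ν)) (covariateOn ν) (lamMin ν) (Mx ν) where
  cont := by unfold covariateOn; fun_prop
  mean_zero := by
    rw [← hA.mean_zero, ← integral_onSubtype measurableSet_suppXY suppXY_mem_ae]
    rfl
  lam_pos := hA.lamMin_pos hdx
  coercive v := by
    rw [← hA.dotProduct_covX]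
    exact sInf_spectrum_mul_le hA.posDef_covX.1 v
  bound s := norm_le_supNorm hA.compact_X continuousOn_id s.2.1

lemma isLipCost (hA : StandingAssumption μ ν) : IsLipCost (costOn μ ν) (costSup μ ν) (Lc μ ν) where
  cont := by unfold costOn cost; fun_prop
  nonneg q := by unfold costOn cost; positivity
  le q := (le_abs_self _).trans (norm_le_supNorm (φ := fun p : E dy × E dy => cost p.1 p.2)
    (hA.compact_U.prod hA.compact_Y) (by unfold cost; fun_prop)
    (a := (q.1.1, q.2.1.2)) ⟨q.1.2, q.2.2.2⟩)
  lip u u' s := by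
    have hu : ‖(u : E dy)‖ ≤ supNorm μ.support (fun u => u) :=
      norm_le_supNorm hA.compact_U continuousOn_id u.2
    have hu' : ‖(u' : E dy)‖ ≤ supNorm μ.support (fun u => u) :=
      norm_le_supNorm hA.compact_U continuousOn_id u'.2
    have hy : ‖s.1.2‖ ≤ supNorm (suppY ν) (fun y => y) :=
      norm_le_supNorm hA.compact_Y continuousOn_id s.2.2
    -- Polarization: the gradient of the quadratic cost at the midpoint has norm at most `Lc`.
    have key : costOn μ ν (u, s) - costOn μ ν (u', s)
        = inner ℝ ((1 / 2 : ℝ) • ((u : E dy) + u') - s.1.2) ((u : E dy) - u') := by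
      have h1 : ∀ a b : E dy, ‖a‖ ^ 2 / 2 - ‖b‖ ^ 2 / 2
          = inner ℝ ((1 / 2 : ℝ) • (a + b)) (a - b) := fun a b => by
        rw [real_inner_smul_left, inner_add_left, inner_sub_right, inner_sub_right,
          real_inner_comm a b, real_inner_self_eq_norm_sq, real_inner_self_eq_norm_sq]
        ring
      rw [costOn, costOn, cost, cost, h1]
      congr 1
      · module
      · abel
    rw [key, Subtype.dist_eq, dist_eq_norm]
    refine (abs_real_inner_le_norm _ _).trans (mul_le_mul_of_nonneg_right ?_ (norm_nonneg _))
    refine (norm_sub_le _ _).trans ?_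
    rw [norm_smul]
    have := norm_add_le (u : E dy) u'
    rw [Lc, Real.norm_of_nonneg (by norm_num : (0 : ℝ) ≤ 1 / 2)]
    linarith

end StandingAssumption

lemma IsSinkhorn.isSinkhornSeq {ε : ℝ} {f : ℕ → E dy → ℝ} {g : ℕ → E dy → E dx}
    {h : ℕ → E dx × E dy → ℝ} {ft : ℕ → E dy → ℝ} {gt : ℕ → E dy → E dx}
    {ht : ℕ → E dx × E dy → ℝ} (hS : IsSinkhorn ε μ ν f g h ft gt ht) :
    IsSinkhornSeq ε (onSubtype μ μ.support) (onSubtype ν (suppXY ν)) (covariateOn ν) (costOn μ ν)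
      (fun t u => f t u) (fun t u => g t u) (fun t s => h t s) (fun t u => ft t u)
      (fun t u => gt t u) (fun t s => ht t s) where
  init := (isCentered_iff_isNormalized _ _ _).2 hS.init
  step t :=
    { eq_g := fun u => by
        rw [← hS.step_g t u u.2, ← integral_onSubtype measurableSet_suppXY suppXY_mem_ae]
        rfl
      eq_f := fun u => by
        rw [hS.step_f t u u.2, ← integral_onSubtype measurableSet_suppXY suppXY_mem_ae]
        rfl
      eq_h := fun s => by
        rw [hS.step_h t s s.2, ← integral_onSubtype measurableSet_support Measure.support_mem_ae]
        rfl }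
  norm_f t := by
    funext u
    rw [hS.norm_f t u u.2, ← integral_onSubtype measurableSet_support Measure.support_mem_ae]
  norm_g t := by
    funext u
    rw [hS.norm_g t u u.2, ← integral_onSubtype measurableSet_support Measure.support_mem_ae]
  norm_h t := by
    funext s
    rw [hS.norm_h t s s.2, ← integral_onSubtype measurableSet_support Measure.support_mem_ae,
      ← integral_onSubtype measurableSet_support Measure.support_mem_ae]
    rfl

end Transfer

/-! ### A priori bounds in the original constants, and the rate -/

section

lemma supNorm_nonneg {α F : Type*} [SeminormedAddCommGroup F] (s : Set α) (φ : α → F) :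
    0 ≤ supNorm s φ := Real.iSup_nonneg fun _ => norm_nonneg _

variable {dx dy : ℕ} {μ : Measure (E dy)} {ν : Measure (E dx × E dy)}
  [IsProbabilityMeasure μ] [IsProbabilityMeasure ν]

lemma IsNormalized.inDualDomain {ε : ℝ} (hA : StandingAssumption μ ν) {f : E dy → ℝ}
    {g : E dy → E dx} {h : E dx × E dy → ℝ} (hn : IsNormalized μ ν f g h) :
    InDualDomain ε μ ν f g h := by
  have := isCompact_iff_compactSpace.1 hA.compact_suppXY
  have := isCompact_iff_compactSpace.1 hA.compact_U
  have := isProbabilityMeasure_onSubtype (measurableSet_suppXY (ν := ν)) suppXY_mem_ae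
  have := isProbabilityMeasure_onSubtype (measurableSet_support (μ := μ)) Measure.support_mem_ae
  obtain ⟨hf, hg, hh, -, -⟩ := (isCentered_iff_isNormalized f g h).2 hn
  have hX : Continuous (covariateOn ν) := by unfold covariateOn; fun_prop
  have hc := (hA.isLipCost).cont
  refine ⟨(integrable_onSubtype_iff measurableSet_support Measure.support_mem_ae).1
    hf.integrable_of_compactSpace,
    (integrable_onSubtype_iff measurableSet_support Measure.support_mem_ae).1
    hg.integrable_of_compactSpace,
    (integrable_onSubtype_iff measurableSet_suppXY suppXY_mem_ae).1
    hh.integrable_of_compactSpace,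
    (integrable_prod_onSubtype_iff measurableSet_support Measure.support_mem_ae
      measurableSet_suppXY suppXY_mem_ae).1 ?_⟩
  exact ((continuous_slack hX hc hf hg hh).div_const ε).rexp.integrable_of_compactSpace

/-- Makes the midpoint an admissible competitor for the dual potentials in the quadratic growth
estimate. -/
lemma IsNormalized.midpoint {f f' : E dy → ℝ} {g g' : E dy → E dx} {h h' : E dx × E dy → ℝ}
    (hA : StandingAssumption μ ν) (hn : IsNormalized μ ν f g h) (hn' : IsNormalized μ ν f' g' h') :
    IsNormalized μ ν (fun u => (1 / 2 : ℝ) * (f u + f' u)) (fun u => (1 / 2 : ℝ) • (g u + g' u))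
      (fun s => (1 / 2 : ℝ) * (h s + h' s)) := by
  have d := hn.inDualDomain (ε := 1) hA
  have d' := hn'.inDualDomain (ε := 1) hA
  refine ⟨continuousOn_const.mul (hn.cont_f.add hn'.cont_f),
    (hn.cont_g.add hn'.cont_g).const_smul (1 / 2 : ℝ), continuousOn_const.mul (hn.cont_h.add hn'.cont_h),
    ?_, ?_⟩
  · rw [integral_const_mul, integral_add d.int_f d'.int_f, hn.mean_f, hn'.mean_f]; simp
  · rw [integral_smul, integral_add d.int_g d'.int_g, hn.mean_g, hn'.mean_g]; simp

section Bounds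

variable {ε : ℝ} {f : ℕ → E dy → ℝ} {g : ℕ → E dy → E dx} {h : ℕ → E dx × E dy → ℝ}
  {ft : ℕ → E dy → ℝ} {gt : ℕ → E dy → E dx} {ht : ℕ → E dx × E dy → ℝ}

/-- A priori bounds on the normalized iterates. -/
theorem IsSinkhorn.bounds (hdx : 0 < dx) (hε : 0 < ε) (hA : StandingAssumption μ ν)
    (hS : IsSinkhorn ε μ ν f g h ft gt ht) (t : ℕ) :
    (∀ u : μ.support, |f (t + 1) u| ≤ boundF ε μ ν (f 0) (g 0) (h 0)) ∧
    (∀ u : μ.support, ‖g (t + 1) u‖ ≤ boundG ε μ ν (f 0) (g 0) (h 0)) ∧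
    ∀ s : suppXY ν, |h (t + 1) s| ≤ boundH ε μ ν (f 0) (g 0) (h 0) := by
  have := isCompact_iff_compactSpace.1 hA.compact_suppXY
  have := isCompact_iff_compactSpace.1 hA.compact_U
  have := isProbabilityMeasure_onSubtype (measurableSet_suppXY (ν := ν)) suppXY_mem_ae
  have := isProbabilityMeasure_onSubtype (measurableSet_support (μ := μ)) Measure.support_mem_ae
  have HS := hS.isSinkhornSeq
  have hX := hA.isCovariate hdx
  have hc := hA.isLipCost
  have hlam := hA.lamMin_pos hdx
  have hLc : 0 ≤ Lc μ ν := add_nonneg (supNorm_nonneg _ _) (supNorm_nonneg _ _)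
  have hC0 : 0 ≤ costSup μ ν := supNorm_nonneg _ _
  have hM0 : 0 ≤ Mx ν := supNorm_nonneg _ _
  have hH0 : 0 ≤ supNorm (suppX ν ×ˢ suppY ν) (h 0) := supNorm_nonneg _ _
  have hdiam : 0 ≤ Lc μ ν * Metric.diam μ.support := mul_nonneg hLc Metric.diam_nonneg
  have hD0 := HS.dualOn_zero_le_cost hε hX hc
  have hdual := dualObj_eq_dualOn (μ := μ) (ν := ν) ε (f 0) (g 0) (h 0)
  have hf : ∀ u : μ.support, |f (t + 1) u| ≤ boundF ε μ ν (f 0) (g 0) (h 0) := fun u => by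
    refine (HS.abs_f_succ_le hε hX hc (Δ := Lc μ ν * Metric.diam μ.support) (fun u u' =>
      mul_le_mul_of_nonneg_left (Metric.dist_le_diam_of_mem hA.compact_U.isBounded u.2 u'.2)
        hLc) t u).trans ?_
    have := le_max_right (-dualObj ε μ ν (f 0) (g 0) (h 0)) 0
    unfold boundF
    linarith
  have hg : ∀ u : μ.support, ‖g (t + 1) u‖ ≤ boundG ε μ ν (f 0) (g 0) (h 0) := fun u => by
    set B := 4 * costSup μ ν - 3 / 2 * dualObj ε μ ν (f 0) (g 0) (h 0)
      + boundF ε μ ν (f 0) (g 0) (h 0) + supNorm (suppX ν ×ˢ suppY ν) (h 0)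
      + ε * Real.log (3 / 2) with hB
    have h1 := le_max_right (-dualObj ε μ ν (f 0) (g 0) (h 0)) 0
    have h2 := mul_le_mul_of_nonneg_left exp_neg_one_le_log hε.le
    have h3 : costSup μ ν + supNorm (suppX ν ×ˢ suppY ν) (h 0)
        ≤ boundF ε μ ν (f 0) (g 0) (h 0) := by
      unfold boundF; linarith
    -- `B` dominates the thresholds of both the first step and the later ones. The sign of the
    -- leftover terms follows from `hD0`, that is `D₀ ≤ ‖c‖_∞`.
    have h4 : ε * Real.exp (-1) + supNorm (suppX ν ×ˢ suppY ν) (h 0)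
        + supNorm (suppX ν ×ˢ suppY ν) (h 0) + costSup μ ν ≤ B := by linarith
    have h5 := HS.norm_g_succ_le hε hX hc (fun s => norm_le_supNorm hA.compact_suppXY
      hS.init.cont_h s.2) h4 (by rw [← hdual] at hD0 ⊢; linarith) t u
    have hB0 : 0 ≤ B := h4.trans' (by positivity)
    calc ‖g (t + 1) u‖ = (lamMin ν)⁻¹ * (lamMin ν * ‖g (t + 1) u‖) := by field_simp
      _ ≤ covInvNorm ν * (4 * Mx ν * B) :=
          mul_le_mul (hA.inv_lamMin_le hdx) h5 (by positivity) (norm_nonneg _)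
      _ = boundG ε μ ν (f 0) (g 0) (h 0) := by rw [boundG, ← hB]; ring
  have hC := HS.isCentered hε hX hc (t + 1)
  exact ⟨hf, hg, abs_le_of_opt_h hε hc.cont hc.nonneg hc.le hX.bound hC.cont_f hC.cont_g hf hg
    (HS.opt_h hε hX hc t)⟩

end Bounds

/-- The product is `(2 / 3) * l * exp (-3 * K / ε)`, so the stated rate is smaller than the one-step
estimate allows. -/
lemma rate_mul_le_one {ε l M K : ℝ} (hε : 0 < ε) (hl : 0 < l) (hl1 : l ≤ 1) (hM : 1 ≤ M)
    (hK : 0 ≤ K) :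
    l ^ 2 * Real.exp (-5 * K / ε) / (3 * M ^ 2) * (2 * Real.exp (K / ε) ^ 2 * M ^ 2 / l) ≤ 1 := by
  have h1 : l ^ 2 * Real.exp (-5 * K / ε) / (3 * M ^ 2) * (2 * Real.exp (K / ε) ^ 2 * M ^ 2 / l)
      = 2 / 3 * (l * (Real.exp (-5 * K / ε) * Real.exp (K / ε) ^ 2)) := by
    field_simp
  have h2 : Real.exp (-5 * K / ε) * Real.exp (K / ε) ^ 2 ≤ 1 := by
    rw [← Real.exp_nat_mul, ← Real.exp_add, Real.exp_le_one_iff]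
    have : -5 * K / ε + (2 : ℕ) * (K / ε) = -(3 * (K / ε)) := by push_cast; ring
    rw [this]
    have : 0 ≤ K / ε := by positivity
    linarith
  rw [h1]
  have := mul_le_one₀ hl1 (by positivity) h2
  linarith

end

end VQR

end

/-! ### The convergence theorem -/

theorem theorem3p1 {dx dy : ℕ} (hdx : 0 < dx) (ε : ℝ) (hε : 0 < ε)
    (μ : Measure (VQR.E dy)) [IsProbabilityMeasure μ]
    (ν : Measure (VQR.E dx × VQR.E dy)) [IsProbabilityMeasure ν]
    (hA : VQR.StandingAssumption μ ν)
    -- the Sinkhorn iterates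
    (f : ℕ → VQR.E dy → ℝ) (g : ℕ → VQR.E dy → VQR.E dx) (h : ℕ → VQR.E dx × VQR.E dy → ℝ)
    (ft : ℕ → VQR.E dy → ℝ) (gt : ℕ → VQR.E dy → VQR.E dx) (ht : ℕ → VQR.E dx × VQR.E dy → ℝ)
    (hS : VQR.IsSinkhorn ε μ ν f g h ft gt ht)
    -- normalized continuous dual potentials
    (fb : VQR.E dy → ℝ) (gb : VQR.E dy → VQR.E dx) (hb : VQR.E dx × VQR.E dy → ℝ)
    (hn : VQR.IsNormalized μ ν fb gb hb) (hD : VQR.IsDualPotential ε μ ν fb gb hb)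
    -- the constants, enlarged as far as necessary
    (M Kf Kg Kh : ℝ)
    (hM : max 1 (VQR.Mx ν) ≤ M)
    (hKf : VQR.boundF ε μ ν (f 0) (g 0) (h 0) ≤ Kf)
    (hKf' : max (VQR.supNorm μ.support fb) (VQR.supNorm μ.support (f 0)) ≤ Kf)
    (hKg : VQR.boundG ε μ ν (f 0) (g 0) (h 0) ≤ Kg)
    (hKg' : max (VQR.supNorm μ.support gb) (VQR.supNorm μ.support (g 0)) ≤ Kg)
    (hKh : VQR.boundH ε μ ν (f 0) (g 0) (h 0) ≤ Kh)
    (hKh' : max (VQR.supNorm (VQR.suppX ν ×ˢ VQR.suppY ν) hb)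
      (VQR.supNorm (VQR.suppX ν ×ˢ VQR.suppY ν) (h 0)) ≤ Kh) :
    -- all iterates are continuous and normalized, so that the quantities below are finite
    (∀ t : ℕ, VQR.IsNormalized μ ν (f t) (g t) (h t)) ∧
    0 < VQR.rate ε μ ν M Kf Kg Kh ∧
    (∀ t : ℕ,
      VQR.dualObj ε μ ν fb gb hb - VQR.dualObj ε μ ν (f t) (g t) (h t) ≤
        ((1 + VQR.rate ε μ ν M Kf Kg Kh) ^ t)⁻¹ *
          (VQR.dualObj ε μ ν fb gb hb - VQR.dualObj ε μ ν (f 0) (g 0) (h 0))) ∧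
    (fun t : ℕ => ∫ u, ‖f t u - fb u‖ ^ 2 ∂μ + ∫ u, ‖g t u - gb u‖ ^ 2 ∂μ
        + ∫ p, ‖h t p - hb p‖ ^ 2 ∂ν)
      =O[atTop] (fun t : ℕ => ((1 + VQR.rate ε μ ν M Kf Kg Kh) ^ t)⁻¹) := by

  open VQR in
  have := isCompact_iff_compactSpace.1 hA.compact_suppXY
  have := isCompact_iff_compactSpace.1 hA.compact_U
  have := isProbabilityMeasure_onSubtype (measurableSet_suppXY (ν := ν)) suppXY_mem_ae
  have := isProbabilityMeasure_onSubtype (measurableSet_support (μ := μ)) Measure.support_mem_ae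
  have HS := hS.isSinkhornSeq
  have hM1 : 1 ≤ M := (le_max_left _ _).trans hM
  have hX := (hA.isCovariate hdx).mono ((le_max_right _ _).trans hM)
  have hc := hA.isLipCost
  have hlam := hA.lamMin_pos hdx
  have hl : 0 < min 1 (lamMin ν) := lt_min one_pos hlam
  have hnorm : ∀ t, IsNormalized μ ν (f t) (g t) (h t) := fun t =>
    (isCentered_iff_isNormalized _ _ _).1 (HS.isCentered hε hX hc t)
  -- The a priori bounds start at `t = 1`; the initial triplet is covered by the enlargement of the
  -- constants.
  have hf : ∀ t (u : μ.support), |f t u| ≤ Kf := fun t u => by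
    rcases t with _ | t
    · exact (norm_le_supNorm hA.compact_U hS.init.cont_f u.2).trans ((le_max_right _ _).trans hKf')
    · exact ((hS.bounds hdx hε hA t).1 u).trans hKf
  have hg : ∀ t (u : μ.support), ‖g t u‖ ≤ Kg := fun t u => by
    rcases t with _ | t
    · exact (norm_le_supNorm hA.compact_U hS.init.cont_g u.2).trans ((le_max_right _ _).trans hKg')
    · exact ((hS.bounds hdx hε hA t).2.1 u).trans hKg
  have hh : ∀ t (s : suppXY ν), |h t s| ≤ Kh := fun t s => by
    rcases t with _ | t
    · exact (norm_le_supNorm hA.compact_suppXY hS.init.cont_h s.2).trans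
        ((le_max_right _ _).trans hKh')
    · exact ((hS.bounds hdx hε hA t).2.2 s).trans hKh
  set K := Kf + Kg * M + Kh + costSup μ ν with hKdef
  have hK : 0 ≤ K := by
    have h1 := (supNorm_nonneg _ _).trans ((le_max_left _ _).trans hKf')
    have h2 := (supNorm_nonneg _ _).trans ((le_max_left _ _).trans hKg')
    have h3 := (supNorm_nonneg _ _).trans ((le_max_left _ _).trans hKh')
    have h4 : 0 ≤ costSup μ ν := supNorm_nonneg _ _
    positivity
  have hslack := fun t => abs_slack_le (hf t) (hg t) (hh t) hX.bound hc.nonneg hc.le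
  have hslackb := abs_slack_le
    (fun u : μ.support => (norm_le_supNorm hA.compact_U hn.cont_f u.2).trans
      ((le_max_left _ _).trans hKf'))
    (fun u : μ.support => (norm_le_supNorm hA.compact_U hn.cont_g u.2).trans
      ((le_max_left _ _).trans hKg'))
    (fun s : suppXY ν => (norm_le_supNorm hA.compact_suppXY hn.cont_h s.2).trans
      ((le_max_left _ _).trans hKh')) hX.bound hc.nonneg hc.le
  have hnb := (isCentered_iff_isNormalized fb gb hb).2 hn
  have hrate : rate ε μ ν M Kf Kg Kh
      = min 1 (lamMin ν) ^ 2 * Real.exp (-5 * K / ε) / (3 * M ^ 2) := rfl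
  have hpos : 0 < rate ε μ ν M Kf Kg Kh := by rw [hrate]; positivity
  have hgap : ∀ t, dualObj ε μ ν fb gb hb - dualObj ε μ ν (f t) (g t) (h t) ≤
      ((1 + rate ε μ ν M Kf Kg Kh) ^ t)⁻¹ *
        (dualObj ε μ ν fb gb hb - dualObj ε μ ν (f 0) (g 0) (h 0)) := by
    refine le_inv_pow_mul_of_le_mul_sub
      (a := fun t => dualObj ε μ ν fb gb hb - dualObj ε μ ν (f t) (g t) (h t))
      (Q := 2 * Real.exp (K / ε) ^ 2 * M ^ 2 / min 1 (lamMin ν)) (fun t => ?_) hpos.le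
      (by positivity) ?_ fun t => ?_
    · exact sub_nonneg.2 (hD.le_max _ _ _ ((hnorm t).inDualDomain hA))
    · rw [hrate]
      exact rate_mul_le_one hε hl (min_le_left _ _) hM1 hK
    · simp only [sub_sub_sub_cancel_left, dualObj_eq_dualOn]
      exact HS.dualOn_sub_succ_le hε hX hM1 hc hK hnb hslackb t (hslack (t + 1))
  refine ⟨hnorm, hpos, hgap, ?_⟩
  have hκ : 0 < Real.exp (-K / ε) / (4 * ε) * min 1 (lamMin ν) := by positivity
  refine IsBigO.of_bound ((Real.exp (-K / ε) / (4 * ε) * min 1 (lamMin ν))⁻¹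
    * (dualObj ε μ ν fb gb hb - dualObj ε μ ν (f 0) (g 0) (h 0))) (Eventually.of_forall fun t => ?_)
  have hCt := HS.isCentered hε hX hc t
  -- Maximality enters only through this comparison with the midpoint and through nonnegativity of
  -- the gap; no first-order condition for the dual potentials is used.
  have hmid := hD.le_max _ _ _ (((hnorm t).midpoint hA hn).inDualDomain hA)
  rw [dualObj_eq_dualOn, dualObj_eq_dualOn] at hmid
  have hL2 := sq_dist_le_dualOn_sub hε hX hc.cont hCt.cont_f hCt.cont_g hCt.cont_h hnb.cont_f
    hnb.cont_g hnb.cont_h (hslack t) hslackb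
    (by rw [integral_sub hCt.cont_f.integrable_of_compactSpace
      hnb.cont_f.integrable_of_compactSpace, hCt.mean_f, hnb.mean_f, sub_zero])
    (by rw [integral_sub hCt.cont_g.integrable_of_compactSpace
      hnb.cont_g.integrable_of_compactSpace, hCt.mean_g, hnb.mean_g, sub_zero]) hmid
  rw [← dualObj_eq_dualOn, ← dualObj_eq_dualOn,
    integral_onSubtype measurableSet_support Measure.support_mem_ae
      (fun u => (f t u - fb u) ^ 2),
    integral_onSubtype measurableSet_support Measure.support_mem_ae
      (fun u => ‖g t u - gb u‖ ^ 2),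
    integral_onSubtype measurableSet_suppXY suppXY_mem_ae (fun s => (h t s - hb s) ^ 2),
    ← mul_assoc] at hL2
  simp only [Real.norm_eq_abs, sq_abs]
  have hnn : 0 ≤ ∫ u, (f t u - fb u) ^ 2 ∂μ + ∫ u, ‖g t u - gb u‖ ^ 2 ∂μ
      + ∫ p, (h t p - hb p) ^ 2 ∂ν := by positivity
  rw [abs_of_nonneg hnn, abs_of_pos (by positivity), mul_assoc, le_inv_mul_iff₀ hκ]
  refine hL2.trans ((hgap t).trans (le_of_eq (mul_comm _ _)))
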